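/- A \emph{Fine jeep} has a tank of capacity $1$ and consumes one tankload per distance unit; it may put any amount of its tank fuel down at any position and later take fuel that lies at its position. The desert is $[0,d]$, $d>0$, with border $0$ and oasis $d$. Finitely many positions $x\in(0,d]$ carry an initial amount of fuel $a(x)\ge 0$ (depots to be used), and finitely many positions $x\in(0,d]$ must finally carry an amount $b(x)\ge 0$ (depots to be filled); $a=b=0$ elsewhere. Unlimited fuel may be taken at the border; returning fuel there (with credit) is either allowed or not allowed. A \emph{normal algorithm} is a finite sequence of steps (ride within $[0,d]$, load, unload, take fuel at the border, and return fuel at the border if allowed) of one jeep that starts at $0$ with an empty tank, and either ends at $d$ (one-way case), or visits $d$ and ends at $0$ (round-trip case). Its border fuel is the amount taken at the border minus the credited amount returned. The \emph{backward convoy algorithm} moves a convoy from $d$ to $0$. The convoy consists of a forward subconvoy (one single jeep and $k$ double jeeps, with total fuel $f\in[0,1]$) and a backward subconvoy ($m$ double jeeps and $\rho$ ringle jeeps, with total fuel $g$ and emptiness $e=2m+\rho-g$), where $\rho=1$ in the round-trip case and $\rho=0$ in the one-way case. It starts at $d$ with $k=m=0$, $f=1$, $g=0$. The backward subconvoy is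 \emph{improper} if $m=0$ and $g=0$. \emph{Riding.} Per distance unit the forward subconvoy uses $2k+1$ of its fuel $f$, and the backward subconvoy uses $2m+\rho$ of its fuel $g$; but if the backward subconvoy is improper, all of the consumption $2k+1+\rho$ is taken from $f$. When $f=0$, a double jeep with one tankload is added to the forward subconvoy ($k\mapsto k+1$, $f=1$). When $e=1$ and $m\ge1$, a double jeep with one tankload is cancelled from the backward subconvoy ($m\mapsto m-1$, $g\mapsto g-1$). \emph{At each position $x>0$ with $a(x)>0$ or $b(x)>0$} (including $d$), the convoy stops. First, $b(x)$ is put down: the backward subconvoy gives fuel as long as it is proper, cancelling a double jeep with one tankload whenever $e=1$, $m\ge 1$ and more is needed; the rest is given by the forward subconvoy, which adds a double jeep with one tankload whenever $f=0$ and more is needed. Then the forward subconvoy absorbs as much of $a(x)$ as possible, cancelling a double jeep with one tankload ($k\mapsto k-1$, $f=0$) whenever $f=1$, $k\ge 1$ and fuel is left. If $k=0$, $f=1$ and fuel is left, the backward subconvoy absorbs all of the remaining fuel, adding a double jeep with one tankload ($m\mapsto m+1$, $g\mapsto g+1$) whenever $e=0$ and fuel is left. On arrival at $0$ the border fuel of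 the algorithm is $F=(k+1-f)-(g-m)$ if returning fuel at the border is allowed, and $F=k+1-f$ otherwise. \textbf{Theorem.} In the one-way case as well as in the round-trip case, the backward convoy algorithm can be carried out (it reaches the border after finitely many steps), and for every instance of it the following holds. (1) It is optimal: every normal algorithm that leaves at least $b(x)$ fuel at every position $x$ has border fuel at least $F$. (2) It can be executed as a normal algorithm: there is a normal algorithm with border fuel exactly $F$ that leaves exactly $b(x)$ fuel at every $x>0$ and that, at all but finitely many positions, passes forward exactly $k+1+m$ times and backward exactly $k+m+\rho$ times, where $k$ and $m$ are the numbers of double jeeps with which the convoy rides over that position. -/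

import Mathlib

open scoped NNReal

namespace FineJeep

/-- A desert crossing problem for one Fine jeep: tank capacity `1`, consumption one tankload per
distance unit. The border is at `0`. -/
structure Desert where
  /-- position of the oasis -/
  oasis : ℝ
  oasis_pos : 0 < oasis
  /-- amount of fuel that is present beforehand at each position (the depots to be used) -/
  supply : ℝ →₀ ℝ≥0
  /-- amount of fuel that has to be present finally at each position (the depots to be filled) -/
  demand : ℝ →₀ ℝ≥0
  supply_mem : ∀ x ∈ supply.support, 0 < x ∧ x ≤ oasis
  demand_mem : ∀ x ∈ demand.support, 0 < x ∧ x ≤ oasis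
  /-- `true`: the jeep must visit the oasis and end at the border;
  `false`: the jeep must end at the oasis -/
  roundTrip : Bool
  /-- whether fuel may be returned (and is credited) at the border -/
  returnAllowed : Bool

/-- The number of ringle jeeps in the backward convoy. -/
def Desert.ringle (D : Desert) : ℕ := if D.roundTrip then 1 else 0

/-! ### Normal (time-ordered) algorithms -/

structure JeepState where
  /-- position of the jeep -/
  pos : ℝ
  /-- fuel in the tank -/
  tank : ℝ
  /-- fuel that lies at each position -/
  depot : ℝ → ℝ
  /-- fuel taken from the border so far, minus fuel returned there -/
  used : ℝ

/-- The jeep starts at the border, with an empty tank. -/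
def JeepState.start (D : Desert) : JeepState where
  pos := 0
  tank := 0
  depot := fun x => (D.supply x : ℝ)
  used := 0

inductive JeepStep (D : Desert) : JeepState → JeepState → Prop
  /-- ride inside the desert, forward or backward -/
  | ride (s : JeepState) (y : ℝ) (h0 : 0 ≤ y) (h1 : y ≤ D.oasis) (h : |y - s.pos| ≤ s.tank) :
      JeepStep D s { s with pos := y, tank := s.tank - |y - s.pos| }
  /-- take fuel from the depot at the current position -/
  | load (s : JeepState) (t : ℝ) (h0 : 0 ≤ t) (h1 : t ≤ s.depot s.pos) (h2 : s.tank + t ≤ 1) :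
      JeepStep D s { s with
        tank := s.tank + t
        depot := Function.update s.depot s.pos (s.depot s.pos - t) }
  /-- put fuel in the depot at the current position -/
  | unload (s : JeepState) (t : ℝ) (h0 : 0 ≤ t) (h1 : t ≤ s.tank) :
      JeepStep D s { s with
        tank := s.tank - t
        depot := Function.update s.depot s.pos (s.depot s.pos + t) }
  /-- take fuel that is available at the border -/
  | takeAtBorder (s : JeepState) (t : ℝ) (hp : s.pos = 0) (h0 : 0 ≤ t) (h1 : s.tank + t ≤ 1) :
      JeepStep D s { s with tank := s.tank + t, used := s.used + t }
  /-- return fuel at the border, if that is allowed -/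
  | returnAtBorder (s : JeepState) (t : ℝ) (ha : D.returnAllowed = true) (hp : s.pos = 0)
      (h0 : 0 ≤ t) (h1 : t ≤ s.tank) :
      JeepStep D s { s with tank := s.tank - t, used := s.used - t }

/-- `S` is the list of consecutive states of a normal algorithm, with last state `e`, that makes
the required trip (one-way or round trip). -/
structure IsNormalAlgorithm (D : Desert) (S : List JeepState) (e : JeepState) : Prop where
  head : S.head? = some (JeepState.start D)
  chain : S.IsChain (JeepStep D)
  last : S.getLast? = some e
  visits : ∃ s ∈ S, s.pos = D.oasis
  ends : e.pos = if D.roundTrip then 0 else D.oasis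

/-- How often the jeep passes `x` in forward direction (for `x` at which it makes no stop). -/
noncomputable def forwardPasses (S : List JeepState) (x : ℝ) : ℕ :=
  (S.zip S.tail).countP fun p => decide (p.1.pos < x ∧ x < p.2.pos)

/-- How often the jeep passes `x` in backward direction (for `x` at which it makes no stop). -/
noncomputable def backwardPasses (S : List JeepState) (x : ℝ) : ℕ :=
  (S.zip S.tail).countP fun p => decide (p.2.pos < x ∧ x < p.1.pos)

/-! ### The backward convoy algorithm -/

/-- A configuration of the backward convoy: the forward refueling subconvoy consists of one single
jeep and `fwd` double jeeps; the backward refueling subconvoy consists of `bwd` double jeeps and,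
for a round trip, a ringle jeep. -/
structure Convoy where
  pos : ℝ
  fwd : ℕ
  /-- total tank fuel of the forward refueling subconvoy -/
  fwdFuel : ℝ
  bwd : ℕ
  /-- total tank fuel of the backward refueling subconvoy -/
  bwdFuel : ℝ
  /-- fuel that has still to be put at the current position -/
  due : ℝ
  /-- fuel that can still be absorbed at the current position -/
  stock : ℝ

namespace Convoy

/-- One single jeep with one tankload, and an empty ringle jeep in case of a round trip. -/
def start (D : Desert) : Convoy where
  pos := D.oasis
  fwd := 0
  fwdFuel := 1
  bwd := 0
  bwdFuel := 0
  due := (D.demand D.oasis : ℝ)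
  stock := (D.supply D.oasis : ℝ)

/-- The emptiness in the tanks of the backward refueling subconvoy: a double jeep has capacity two
tankloads and a ringle jeep has capacity one tankload. -/
def emptiness (D : Desert) (c : Convoy) : ℝ := 2 * c.bwd + D.ringle - c.bwdFuel

/-- The backward refueling subconvoy has no jeeps, or consists of an empty ringle jeep only. -/
def Improper (c : Convoy) : Prop := c.bwd = 0 ∧ c.bwdFuel = 0

/-- Everything at the current position has been handled, and the border is not yet reached. -/
def Ready (c : Convoy) : Prop := c.due = 0 ∧ c.stock = 0 ∧ 0 < c.pos

/-- The convoy at arrival at position `y`, with given amounts of fuel left. -/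
def arrive (D : Desert) (c : Convoy) (y fwdFuel bwdFuel : ℝ) : Convoy :=
  { c with
    pos := y
    fwdFuel := fwdFuel
    bwdFuel := bwdFuel
    due := (D.demand y : ℝ)
    stock := (D.supply y : ℝ) }

/-- The convoy may ride from its position to `y` without skipping a depot. -/
def FreeRoad (D : Desert) (c : Convoy) (y : ℝ) : Prop :=
  0 ≤ y ∧ y < c.pos ∧ ∀ z, y < z → z < c.pos → D.supply z = 0 ∧ D.demand z = 0

/-- The instructions of the backward convoy algorithm. -/
inductive Step (D : Desert) : Convoy → Convoy → Prop
  /-- Ride with a proper backward refueling subconvoy: each subconvoy uses its own fuel, a double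
  jeep consumes twice as much as a single jeep or a ringle jeep, and the emptiness of the backward
  refueling subconvoy does not exceed one tankload. -/
  | rideProper (c : Convoy) (y : ℝ) (hr : c.Ready) (hy : FreeRoad D c y) (hc : ¬ c.Improper)
      (hf : (2 * c.fwd + 1) * (c.pos - y) ≤ c.fwdFuel)
      (hb : c.emptiness D + (2 * c.bwd + D.ringle) * (c.pos - y) ≤ 1) :
      Step D c (c.arrive D y (c.fwdFuel - (2 * c.fwd + 1) * (c.pos - y))
        (c.bwdFuel - (2 * c.bwd + D.ringle) * (c.pos - y)))
  /-- Ride with an improper backward refueling subconvoy: its empty ringle jeep, if any, uses fuel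
  of the forward refueling subconvoy. -/
  | rideImproper (c : Convoy) (y : ℝ) (hr : c.Ready) (hy : FreeRoad D c y) (hc : c.Improper)
      (hf : (2 * c.fwd + 1 + D.ringle) * (c.pos - y) ≤ c.fwdFuel) :
      Step D c (c.arrive D y (c.fwdFuel - (2 * c.fwd + 1 + D.ringle) * (c.pos - y)) c.bwdFuel)
  /-- The forward refueling subconvoy is out of fuel, while fuel is needed for riding, or for a
  depot to which the backward refueling subconvoy can give nothing: add a double jeep with one
  tankload. -/
  | createForward (c : Convoy) (hn : c.Ready ∨ (0 < c.due ∧ c.Improper)) (hf : c.fwdFuel = 0) :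
      Step D c { c with fwd := c.fwd + 1, fwdFuel := 1 }
  /-- The backward refueling subconvoy has one tankload of emptiness, and has to consume or give
  more: cancel one of its double jeeps, with one tankload. -/
  | cancelBackward (c : Convoy) (m : ℕ) (hn : c.Ready ∨ 0 < c.due) (hm : c.bwd = m + 1)
      (he : c.emptiness D = 1) :
      Step D c { c with bwd := m, bwdFuel := c.bwdFuel - 1 }
  /-- Depot to be filled: use fuel of the backward refueling subconvoy. -/
  | giveBackward (c : Convoy) (hd : 0 < c.due) (hc : ¬ c.Improper) (he : c.emptiness D < 1) :
      Step D c { c with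
        bwdFuel := c.bwdFuel - min c.due (1 - c.emptiness D)
        due := c.due - min c.due (1 - c.emptiness D) }
  /-- Depot to be filled: if the backward refueling subconvoy cannot give any more, use fuel of the
  forward refueling subconvoy. -/
  | giveForward (c : Convoy) (hd : 0 < c.due) (hc : c.Improper) (hf : 0 < c.fwdFuel) :
      Step D c { c with
        fwdFuel := c.fwdFuel - min c.due c.fwdFuel
        due := c.due - min c.due c.fwdFuel }
  /-- Depot to be used (after filling): the forward refueling subconvoy absorbs fuel. -/
  | absorbForward (c : Convoy) (hd : c.due = 0) (hs : 0 < c.stock) (hf : c.fwdFuel < 1) :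
      Step D c { c with
        fwdFuel := c.fwdFuel + min c.stock (1 - c.fwdFuel)
        stock := c.stock - min c.stock (1 - c.fwdFuel) }
  /-- Depot to be used: the forward refueling subconvoy would get more than one tankload; it
  cancels a double jeep, with one tankload. -/
  | cancelForward (c : Convoy) (k : ℕ) (hd : c.due = 0) (hs : 0 < c.stock) (hk : c.fwd = k + 1)
      (hf : c.fwdFuel = 1) :
      Step D c { c with fwd := k, fwdFuel := 0 }
  /-- Saturation point: the backward refueling subconvoy absorbs fuel. -/
  | absorbBackward (c : Convoy) (hd : c.due = 0) (hs : 0 < c.stock) (hk : c.fwd = 0)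
      (hf : c.fwdFuel = 1) (he : 0 < c.emptiness D) :
      Step D c { c with
        bwdFuel := c.bwdFuel + min c.stock (c.emptiness D)
        stock := c.stock - min c.stock (c.emptiness D) }
  /-- Saturation point: there is more fuel than the backward refueling subconvoy can absorb; it
  creates a double jeep, with one tankload. -/
  | createBackward (c : Convoy) (hd : c.due = 0) (hs : 0 < c.stock) (hk : c.fwd = 0)
      (hf : c.fwdFuel = 1) (he : c.emptiness D = 0) :
      Step D c { c with bwd := c.bwd + 1, bwdFuel := c.bwdFuel + 1 }

/-- The fuel used from the border if the convoy `c` arrives there: all jeeps of the forward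
refueling subconvoy are filled up to one tankload each; if that is allowed, the fuel of the
backward refueling subconvoy above one tankload for each double jeep, and all fuel of the ringle
jeep, is returned. -/
def borderFuel (D : Desert) (c : Convoy) : ℝ :=
  ((c.fwd + 1 : ℝ) - c.fwdFuel) - (if D.returnAllowed then c.bwdFuel - c.bwd else 0)

end Convoy

/-- `T` is the list of consecutive configurations in an instance of the backward convoy algorithm,
ridden from the oasis to the border, with last configuration `c`. -/
structure IsConvoyAlgorithm (D : Desert) (T : List Convoy) (c : Convoy) : Prop where
  head : T.head? = some (Convoy.start D)
  chain : T.IsChain (Convoy.Step D)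
  last : T.getLast? = some c
  ends : c.pos = 0

/-- The normal algorithm `S` with last state `e` executes the instance `T` of the backward convoy
algorithm with last configuration `c`: it has the same effect on the depots, it uses the same
amount of fuel from the border, and (at all but finitely many positions) it passes forward and
backward as often as the jeeps of the convoy do: a single jeep stands for a forward passage, a
ringle jeep for a backward passage, and a double jeep for one passage in each direction. -/
structure Executes (D : Desert) (S : List JeepState) (e : JeepState) (T : List Convoy)
    (c : Convoy) : Prop where
  normal : IsNormalAlgorithm D S e
  depots : ∀ x, 0 < x → e.depot x = (D.demand x : ℝ)
  fuel : e.used = c.borderFuel D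
  passes : ∀ p ∈ T.zip T.tail, {x : ℝ | p.2.pos < x ∧ x < p.1.pos ∧
    ¬ (forwardPasses S x = p.1.fwd + 1 + p.1.bwd ∧
       backwardPasses S x = p.1.fwd + p.1.bwd + D.ringle)}.Finite

end FineJeep

/-! ### Bounds kept by the convoy -/

namespace FineJeep

/-! Two numbers carry the argument: `outward` = k + 1 - f, the fuel that the forward subconvoy
demands from the border side, and `homeward` = g - m, the fuel that the backward subconvoy sends to
the border. The border fuel is `outward - homeward` with credit and `outward` without.

Feasibility: at a fixed position every instruction makes progress. On the road, each tankload added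
while there are i double jeeps lasts for a distance of at least 1/(2i+2), and the harmonic series
diverges, so any distance is covered (`exists_arrival_aux`).

Optimality: for an arbitrary trip, follow the net fuel carried forward across x up to time n.
`Dominates` asserts that, apart from what is still due or in stock at x, this is at least `outward`
at some moment with the jeep at or beyond x, and at least `outward - homeward` at the end. The core
is `Trip.ride_gap`, on an interval without stops. A passage carries at most one tankload, so a net
amount above k forces k + 1 forward passages by that moment, hence k backward ones. If the net
return afterwards exceeds m + ρ - 1, at least m + ρ backward passages follow; otherwise the final
bound holds anyway. So the trip burns at least as much as the convoy. Stops inside the interval are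
removed by induction (`Trip.ride`).

Execution: a single jeep imitates the convoy by plans built from the oasis towards the border. An
`OutPlan` starts and ends at x, consuming `need` and leaving `left` there; in the one-way case it is
followed by a `HomePlan`, the final ride to the oasis. Riding prepends transports over the new
stretch (`Plan.arrive`), while the other instructions only change the fuel kept at x (`Plan.add`).
-/

theorem Desert.ringle_eq (D : Desert) : (D.ringle : ℝ) = 0 ∨ (D.ringle : ℝ) = 1 := by
  unfold Desert.ringle
  split <;> simp

theorem Desert.supply_eq_zero (D : Desert) {x : ℝ} (hx : x ≤ 0 ∨ D.oasis < x) :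
    D.supply x = 0 := by
  by_contra h
  have := D.supply_mem x (Finsupp.mem_support_iff.2 h)
  rcases hx with hx | hx <;> linarith [this.1, this.2]

theorem Desert.demand_eq_zero (D : Desert) {x : ℝ} (hx : x ≤ 0 ∨ D.oasis < x) :
    D.demand x = 0 := by
  by_contra h
  have := D.demand_mem x (Finsupp.mem_support_iff.2 h)
  rcases hx with hx | hx <;> linarith [this.1, this.2]

namespace Convoy

/-- The net amount of fuel that the forward refueling subconvoy needs from the border side. -/
def outward (c : Convoy) : ℝ := c.fwd + 1 - c.fwdFuel

/-- The net amount of fuel that the backward refueling subconvoy brings towards the border. -/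
def homeward (c : Convoy) : ℝ := c.bwdFuel - c.bwd

/-- The bounds that hold for each configuration during the backward convoy algorithm. -/
structure Sound (D : Desert) (c : Convoy) : Prop where
  pos_nonneg : 0 ≤ c.pos
  pos_le : c.pos ≤ D.oasis
  fwdFuel_nonneg : 0 ≤ c.fwdFuel
  fwdFuel_le : c.fwdFuel ≤ 1
  bwdFuel_nonneg : 0 ≤ c.bwdFuel
  emptiness_nonneg : 0 ≤ c.emptiness D
  emptiness_le : c.emptiness D ≤ 1
  due_nonneg : 0 ≤ c.due
  stock_nonneg : 0 ≤ c.stock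
  border : c.pos = 0 → c.due = 0 ∧ c.stock = 0

theorem sound_start (D : Desert) : Sound D (start D) where
  pos_nonneg := D.oasis_pos.le
  pos_le := le_rfl
  fwdFuel_nonneg := by simp [start]
  fwdFuel_le := by simp [start]
  bwdFuel_nonneg := by simp [start]
  emptiness_nonneg := by simp [start, emptiness]
  emptiness_le := by
    rcases D.ringle_eq with h | h <;> simp [start, emptiness, h]
  due_nonneg := NNReal.coe_nonneg _
  stock_nonneg := NNReal.coe_nonneg _
  border h := absurd h D.oasis_pos.ne'

theorem Sound.arrive {D : Desert} {c : Convoy} (hc : Sound D c) {y f g : ℝ} (hy : 0 ≤ y)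
    (hyc : y ≤ c.pos) (hf : 0 ≤ f) (hfc : f ≤ c.fwdFuel) (hg : 0 ≤ g) (hgc : g ≤ c.bwdFuel)
    (he : 2 * c.bwd + D.ringle - g ≤ 1) : Sound D (c.arrive D y f g) where
  pos_nonneg := hy
  pos_le := hyc.trans hc.pos_le
  fwdFuel_nonneg := hf
  fwdFuel_le := hfc.trans hc.fwdFuel_le
  bwdFuel_nonneg := hg
  emptiness_nonneg := by
    have := hc.emptiness_nonneg
    simp only [emptiness, Convoy.arrive] at *
    linarith
  emptiness_le := he
  due_nonneg := NNReal.coe_nonneg _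
  stock_nonneg := NNReal.coe_nonneg _
  border h := by
    have h : y = 0 := h
    simp [Convoy.arrive, h, D.supply_eq_zero (Or.inl le_rfl), D.demand_eq_zero (Or.inl le_rfl)]

theorem Sound.bwdFuel_eq_zero {D : Desert} {c : Convoy} (hc : Sound D c) (hm : c.bwd = 0)
    (hr : (D.ringle : ℝ) = 0) : c.bwdFuel = 0 := by
  have h1 := hc.bwdFuel_nonneg
  have h2 := hc.emptiness_nonneg
  simp only [emptiness, hm, hr] at h2
  push_cast at h2
  linarith

/-- Emptiness at most one gives g ≥ 2m + ρ - 1, which is at least m once m ≥ 1. Hence `homeward` is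
never negative, as a credit at the border requires. -/
theorem Sound.bwd_le_bwdFuel {D : Desert} {c : Convoy} (hc : Sound D c) :
    (c.bwd : ℝ) ≤ c.bwdFuel := by
  have h1 := hc.bwdFuel_nonneg
  have h2 := hc.emptiness_le
  rcases Nat.eq_zero_or_pos c.bwd with h | h
  · simpa [h] using h1
  · have h : (1 : ℝ) ≤ c.bwd := by exact_mod_cast h
    simp only [emptiness] at h2
    rcases D.ringle_eq with hr | hr <;> rw [hr] at h2 <;> linarith

/-- Emptiness at most one on arrival leaves fuel at least 2m + ρ - 1. This is negative only for m =
ρ = 0, where nothing is consumed. -/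
theorem Sound.rideProper_bwdFuel_nonneg {D : Desert} {c : Convoy} {h : ℝ}
    (hc : Sound D c) (hb : c.emptiness D + (2 * c.bwd + D.ringle) * h ≤ 1) :
    0 ≤ c.bwdFuel - (2 * c.bwd + D.ringle) * h := by
  have h1 := hc.bwdFuel_nonneg
  have h3 := hc.emptiness_nonneg
  rcases Nat.eq_zero_or_pos c.bwd with h' | h'
  · rcases D.ringle_eq with hr | hr
    · simp [h', hr, h1]
    · simp only [emptiness, h', hr] at *
      push_cast at *
      linarith
  · have h' : (1 : ℝ) ≤ c.bwd := by exact_mod_cast h'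
    simp only [emptiness] at hb
    rcases D.ringle_eq with hr | hr <;> rw [hr] at hb ⊢ <;> linarith

theorem Step.sound {D : Desert} {c c' : Convoy} (hs : Step D c c') (hc : Sound D c) :
    Sound D c' := by
  have hρ : (0 : ℝ) ≤ D.ringle := Nat.cast_nonneg _
  have hm0 : (0 : ℝ) ≤ c.bwd := Nat.cast_nonneg _
  have hk0 : (0 : ℝ) ≤ c.fwd := Nat.cast_nonneg _
  obtain ⟨h1, h2, h3, h4, h5, h6, h7, h8, h9, h10⟩ := hc
  have hc : Sound D c := ⟨h1, h2, h3, h4, h5, h6, h7, h8, h9, h10⟩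
  cases hs with
  | rideProper y hr hy hi hf hb =>
    have hy' : 0 ≤ c.pos - y := by linarith [hy.2.1]
    have hp : 0 ≤ (2 * c.bwd + D.ringle) * (c.pos - y) := by positivity
    have hq : 0 ≤ (2 * c.fwd + 1) * (c.pos - y) := by positivity
    refine hc.arrive hy.1 hy.2.1.le (by linarith) (by linarith)
      (hc.rideProper_bwdFuel_nonneg hb) (by linarith) ?_
    simp only [emptiness] at hb
    linarith
  | rideImproper y hr hy hi hf =>
    have hy' : 0 ≤ c.pos - y := by linarith [hy.2.1]
    have hq : 0 ≤ (2 * c.fwd + 1 + D.ringle) * (c.pos - y) := by positivity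
    exact hc.arrive hy.1 hy.2.1.le (by linarith) (by linarith) h5 le_rfl h7
  | createForward hn hf => exact ⟨h1, h2, zero_le_one, le_rfl, h5, h6, h7, h8, h9, h10⟩
  | cancelBackward m hn hm he =>
    simp only [emptiness, hm] at he
    push_cast at he
    refine ⟨h1, h2, h3, h4, ?_, ?_, ?_, h8, h9, h10⟩ <;> simp only [emptiness] <;>
      linarith [(Nat.cast_nonneg m : (0 : ℝ) ≤ m)]
  | giveBackward hd hi he =>
    have a1 := min_le_left c.due (1 - c.emptiness D)
    have a2 := min_le_right c.due (1 - c.emptiness D)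
    have a3 : 0 ≤ min c.due (1 - c.emptiness D) := le_min h8 (by linarith)
    have a4 : (c.bwd : ℝ) = 0 ∨ 1 ≤ (c.bwd : ℝ) := by
      rcases Nat.eq_zero_or_pos c.bwd with h | h
      · exact Or.inl (by simp [h])
      · exact Or.inr (by exact_mod_cast h)
    -- The one case in which emptiness at most one would not protect `bwdFuel` from becoming
    -- negative; properness excludes it.
    have a5 : (c.bwd : ℝ) = 0 → (D.ringle : ℝ) = 0 → False := fun h h' =>
      hi ⟨by exact_mod_cast h, hc.bwdFuel_eq_zero (by exact_mod_cast h) h'⟩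
    generalize min c.due (1 - c.emptiness D) = t at *
    refine ⟨h1, h2, h3, h4, ?_, ?_, ?_, by simp only; linarith, h9, fun h => ?_⟩
    · simp only [emptiness] at *
      rcases a4 with h | h <;> rcases D.ringle_eq with h' | h' <;> rw [h'] at a2
      · exact (a5 h h').elim
      all_goals linarith
    · simp only [emptiness] at *; linarith
    · simp only [emptiness] at *; linarith
    · exact absurd (h10 h).1 hd.ne'
  | giveForward hd hi hf =>
    have a1 := min_le_left c.due c.fwdFuel
    have a2 := min_le_right c.due c.fwdFuel
    have a3 : 0 ≤ min c.due c.fwdFuel := le_min h8 h3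
    exact ⟨h1, h2, by simp only; linarith, by simp only; linarith, h5, h6, h7,
      by simp only; linarith, h9, fun h => absurd (h10 h).1 hd.ne'⟩
  | absorbForward hd hs hf =>
    have a1 := min_le_left c.stock (1 - c.fwdFuel)
    have a2 := min_le_right c.stock (1 - c.fwdFuel)
    have a3 : 0 ≤ min c.stock (1 - c.fwdFuel) := le_min h9 (by linarith)
    exact ⟨h1, h2, by simp only; linarith, by simp only; linarith, h5, h6, h7, h8,
      by simp only; linarith, fun h => absurd (h10 h).2 hs.ne'⟩
  | cancelForward k hd hs hk hf => exact ⟨h1, h2, le_rfl, zero_le_one, h5, h6, h7, h8, h9, h10⟩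
  | absorbBackward hd hs hk hf he =>
    have a1 := min_le_left c.stock (c.emptiness D)
    have a2 := min_le_right c.stock (c.emptiness D)
    have a3 : 0 ≤ min c.stock (c.emptiness D) := le_min h9 h6
    generalize min c.stock (c.emptiness D) = t at *
    refine ⟨h1, h2, h3, h4, by simp only; linarith, ?_, ?_, h8,
      by simp only; linarith, fun h => absurd (h10 h).2 hs.ne'⟩ <;>
      simp only [emptiness] at * <;> linarith
  | createBackward hd hs hk hf he =>
    refine ⟨h1, h2, h3, h4, by simp only; linarith, ?_, ?_, h8, h9, h10⟩ <;>
      simp only [emptiness] at * <;> push_cast <;> linarith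

end Convoy
end FineJeep

/-! ### The convoy reaches the border after finitely many steps -/

namespace FineJeep
namespace Convoy

open Relation

theorem sound_of_reflTransGen {D : Desert} {c c' : Convoy} (h : ReflTransGen (Step D) c c')
    (hc : Sound D c) : Sound D c' := by
  induction h with
  | refl => exact hc
  | tail _ h ih => exact h.sound ih

/-- Giving ends at zero due or at emptiness one; in the latter case cancelling a double jeep resets
the emptiness to zero, so induction on the number of double jeeps applies. With none left, emptiness
one means an empty ringle jeep. -/
theorem exists_due_eq_zero_or_improper {D : Desert} (m : ℕ) (c : Convoy) (hc : Sound D c)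
    (hm : c.bwd = m) : ∃ c', ReflTransGen (Step D) c c' ∧ c'.pos = c.pos ∧
      (c'.due = 0 ∨ c'.Improper) := by
  induction m generalizing c with
  | zero =>
    by_cases hi : c.Improper
    · exact ⟨c, .refl, rfl, Or.inr hi⟩
    rcases hc.due_nonneg.eq_or_lt with hd | hd
    · exact ⟨c, .refl, rfl, Or.inl hd.symm⟩
    have hg : c.bwdFuel ≠ 0 := fun h => hi ⟨hm, h⟩
    have hg' := lt_of_le_of_ne hc.bwdFuel_nonneg hg.symm
    have hr : (D.ringle : ℝ) = 1 := D.ringle_eq.resolve_left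
      fun h => hg (hc.bwdFuel_eq_zero hm h)
    have he : c.emptiness D = 1 - c.bwdFuel := by simp [emptiness, hm, hr]
    have st := Step.giveBackward c hd hi (by rw [he]; linarith)
    refine ⟨_, .single st, rfl, ?_⟩
    rcases le_total c.due (1 - c.emptiness D) with h | h
    · left; simp [min_eq_left h]
    · right; exact ⟨hm, by simp only [min_eq_right h]; linarith⟩
  | succ m ih =>
    rcases hc.due_nonneg.eq_or_lt with hd | hd
    · exact ⟨c, .refl, rfl, Or.inl hd.symm⟩
    have key : ∀ c : Convoy, Sound D c → c.bwd = m + 1 → 0 < c.due → c.emptiness D = 1 →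
        ∃ c', ReflTransGen (Step D) c c' ∧ c'.pos = c.pos ∧ (c'.due = 0 ∨ c'.Improper) := by
      intro c hc hm hd he
      have st := Step.cancelBackward c m (Or.inr hd) hm he
      obtain ⟨c', h1, h2, h3⟩ := ih _ (st.sound hc) rfl
      exact ⟨c', .head st h1, h2, h3⟩
    rcases hc.emptiness_le.eq_or_lt with he | he
    · exact key c hc hm hd he
    have st := Step.giveBackward c hd (fun h => by simp [h.1] at hm) he
    rcases le_or_gt c.due (1 - c.emptiness D) with h | h
    · exact ⟨_, .single st, rfl, Or.inl (by simp [min_eq_left h])⟩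
    · obtain ⟨c', h1, h2, h3⟩ := key _ (st.sound hc) hm
        (by simp only [min_eq_right h.le]; linarith)
        (by rw [min_eq_right h.le]; simp only [emptiness]; ring)
      exact ⟨c', .head st h1, h2, h3⟩

/-- Once `fwdFuel` is zero, adding a double jeep and giving its tankload lowers the due by one, so
any natural number above the due bounds the number of rounds. -/
theorem exists_due_eq_zero_of_improper {D : Desert} (c : Convoy) (hc : Sound D c)
    (hi : c.Improper) : ∃ c', ReflTransGen (Step D) c c' ∧ c'.pos = c.pos ∧ c'.due = 0 := by
  have key : ∀ (n : ℕ) (c : Convoy), Sound D c → c.Improper → c.fwdFuel = 0 → c.due ≤ n →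
      ∃ c', ReflTransGen (Step D) c c' ∧ c'.pos = c.pos ∧ c'.due = 0 := by
    intro n
    induction n with
    | zero =>
      intro c hc hi hf hn
      exact ⟨c, .refl, rfl, le_antisymm (by simpa using hn) hc.due_nonneg⟩
    | succ n ih =>
      intro c hc hi hf hn
      rcases hc.due_nonneg.eq_or_lt with hd | hd
      · exact ⟨c, .refl, rfl, hd.symm⟩
      have s1 := Step.createForward (D := D) c (Or.inr ⟨hd, hi⟩) hf
      have s2 := Step.giveForward (D := D) { c with fwd := c.fwd + 1, fwdFuel := 1 } hd hi zero_lt_one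
      have hr := (ReflTransGen.single s1).tail s2
      rcases le_or_gt c.due 1 with h | h
      · exact ⟨_, hr, rfl, by simp [min_eq_left h]⟩
      · push_cast at hn
        obtain ⟨c', h1, h2, h3⟩ := ih _ (sound_of_reflTransGen hr hc) hi
          (by simp [min_eq_right h.le]) (by simp only [min_eq_right h.le]; linarith)
        exact ⟨c', hr.trans h1, h2, h3⟩
  rcases hc.due_nonneg.eq_or_lt with hd | hd
  · exact ⟨c, .refl, rfl, hd.symm⟩
  rcases hc.fwdFuel_nonneg.eq_or_lt with hf | hf
  · obtain ⟨n, hn⟩ := exists_nat_ge c.due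
    exact key n c hc hi hf.symm hn
  have st := Step.giveForward (D := D) c hd hi hf
  rcases le_total c.due c.fwdFuel with h | h
  · exact ⟨_, .single st, rfl, by simp [min_eq_left h]⟩
  · obtain ⟨n, hn⟩ := exists_nat_ge (c.due - min c.due c.fwdFuel)
    obtain ⟨c', h1, h2, h3⟩ := key n _ (st.sound hc) hi (by simp [min_eq_right h]) hn
    exact ⟨c', .head st h1, h2, h3⟩

theorem exists_stock_eq_zero_or_saturated {D : Desert} (k : ℕ) (c : Convoy) (hc : Sound D c)
    (hd : c.due = 0) (hk : c.fwd = k) : ∃ c', ReflTransGen (Step D) c c' ∧ c'.pos = c.pos ∧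
      c'.due = 0 ∧ (c'.stock = 0 ∨ (c'.fwd = 0 ∧ c'.fwdFuel = 1)) := by
  induction k generalizing c with
  | zero =>
    rcases hc.stock_nonneg.eq_or_lt with hs | hs
    · exact ⟨c, .refl, rfl, hd, Or.inl hs.symm⟩
    rcases hc.fwdFuel_le.eq_or_lt with hf | hf
    · exact ⟨c, .refl, rfl, hd, Or.inr ⟨hk, hf⟩⟩
    refine ⟨_, .single (Step.absorbForward c hd hs hf), rfl, hd, ?_⟩
    rcases le_total c.stock (1 - c.fwdFuel) with h | h
    · left; simp [min_eq_left h]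
    · right; exact ⟨hk, by simp [min_eq_right h]⟩
  | succ k ih =>
    rcases hc.stock_nonneg.eq_or_lt with hs | hs
    · exact ⟨c, .refl, rfl, hd, Or.inl hs.symm⟩
    have key : ∀ c : Convoy, Sound D c → c.due = 0 → c.fwd = k + 1 → 0 < c.stock →
        c.fwdFuel = 1 → ∃ c', ReflTransGen (Step D) c c' ∧ c'.pos = c.pos ∧
        c'.due = 0 ∧ (c'.stock = 0 ∨ (c'.fwd = 0 ∧ c'.fwdFuel = 1)) := by
      intro c hc hd hk hs hf
      have st := Step.cancelForward (D := D) c k hd hs hk hf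
      obtain ⟨c', h1, h2, h3⟩ := ih _ (st.sound hc) hd rfl
      exact ⟨c', .head st h1, h2, h3⟩
    rcases hc.fwdFuel_le.eq_or_lt with hf | hf
    · exact key c hc hd hk hs hf
    have st := Step.absorbForward (D := D) c hd hs hf
    rcases le_or_gt c.stock (1 - c.fwdFuel) with h | h
    · exact ⟨_, .single st, rfl, hd, Or.inl (by simp [min_eq_left h])⟩
    · obtain ⟨c', h1, h2, h3⟩ := key _ (st.sound hc) hd hk
        (by simp only [min_eq_right h.le]; linarith) (by simp [min_eq_right h.le])
      exact ⟨c', .head st h1, h2, h3⟩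

/-- From emptiness zero, creating a double jeep raises the emptiness to one, and absorbing then
removes one unit of stock. -/
theorem exists_stock_eq_zero_of_saturated {D : Desert} (c : Convoy) (hc : Sound D c)
    (hd : c.due = 0) (hk : c.fwd = 0) (hf : c.fwdFuel = 1) :
    ∃ c', ReflTransGen (Step D) c c' ∧ c'.pos = c.pos ∧ c'.due = 0 ∧ c'.stock = 0 := by
  have key : ∀ (n : ℕ) (c : Convoy), Sound D c → c.due = 0 → c.fwd = 0 → c.fwdFuel = 1 →
      c.emptiness D = 0 → c.stock ≤ n →
      ∃ c', ReflTransGen (Step D) c c' ∧ c'.pos = c.pos ∧ c'.due = 0 ∧ c'.stock = 0 := by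
    intro n
    induction n with
    | zero =>
      intro c hc hd hk hf he hn
      exact ⟨c, .refl, rfl, hd, le_antisymm (by simpa using hn) hc.stock_nonneg⟩
    | succ n ih =>
      intro c hc hd hk hf he hn
      rcases hc.stock_nonneg.eq_or_lt with hs | hs
      · exact ⟨c, .refl, rfl, hd, hs.symm⟩
      have s1 := Step.createBackward c hd hs hk hf he
      have he1 : emptiness D { c with bwd := c.bwd + 1, bwdFuel := c.bwdFuel + 1 } = 1 := by
        simp only [emptiness] at *
        push_cast
        linarith
      have s2 := Step.absorbBackward { c with bwd := c.bwd + 1, bwdFuel := c.bwdFuel + 1 }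
        hd hs hk hf (by rw [he1]; exact zero_lt_one)
      rw [he1] at s2
      have hr := (ReflTransGen.single s1).tail s2
      rcases le_or_gt c.stock 1 with h | h
      · exact ⟨_, hr, rfl, hd, by simp [min_eq_left h]⟩
      · push_cast at hn
        obtain ⟨c', h1, h2, h3⟩ := ih _ (sound_of_reflTransGen hr hc) hd hk hf
          (by simp only [min_eq_right h.le, emptiness] at *; linarith)
          (by simp only [min_eq_right h.le]; linarith)
        exact ⟨c', hr.trans h1, h2, h3⟩
  rcases hc.stock_nonneg.eq_or_lt with hs | hs
  · exact ⟨c, .refl, rfl, hd, hs.symm⟩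
  rcases hc.emptiness_nonneg.eq_or_lt with he | he
  · obtain ⟨n, hn⟩ := exists_nat_ge c.stock
    exact key n c hc hd hk hf he.symm hn
  have st := Step.absorbBackward c hd hs hk hf he
  rcases le_total c.stock (c.emptiness D) with h | h
  · exact ⟨_, .single st, rfl, hd, by simp [min_eq_left h]⟩
  · obtain ⟨n, hn⟩ := exists_nat_ge (c.stock - min c.stock (c.emptiness D))
    obtain ⟨c', h1, h2, h3⟩ := key n _ (st.sound hc) hd hk hf
      (by rw [min_eq_right h]; simp only [emptiness]; ring) hn
    exact ⟨c', .head st h1, h2, h3⟩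

/-- The convoy can handle everything at its current position. -/
theorem exists_settled {D : Desert} (c : Convoy) (hc : Sound D c) :
    ∃ c', ReflTransGen (Step D) c c' ∧ c'.pos = c.pos ∧ c'.due = 0 ∧ c'.stock = 0 := by
  have h1 : ∃ c', ReflTransGen (Step D) c c' ∧ c'.pos = c.pos ∧ c'.due = 0 := by
    obtain ⟨c1, r1, p1, h | h⟩ := exists_due_eq_zero_or_improper _ c hc rfl
    · exact ⟨c1, r1, p1, h⟩
    · obtain ⟨c2, r2, p2, h⟩ := exists_due_eq_zero_of_improper c1 (sound_of_reflTransGen r1 hc) h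
      exact ⟨c2, r1.trans r2, p2.trans p1, h⟩
  obtain ⟨c1, r1, p1, d1⟩ := h1
  have hc1 := sound_of_reflTransGen r1 hc
  obtain ⟨c2, r2, p2, d2, h | h⟩ := exists_stock_eq_zero_or_saturated _ c1 hc1 d1 rfl
  · exact ⟨c2, r1.trans r2, p2.trans p1, d2, h⟩
  · obtain ⟨c3, r3, p3, d3, s3⟩ := exists_stock_eq_zero_of_saturated c2
      (sound_of_reflTransGen r2 hc1) d2 h.1 h.2
    exact ⟨c3, (r1.trans r2).trans r3, p3.trans (p2.trans p1), d3, s3⟩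

/-- `0` for an improper backward refueling subconvoy, and more than the number of its double jeeps
otherwise. -/
noncomputable def bwdRank (c : Convoy) : ℕ := open Classical in if c.Improper then 0 else c.bwd + 1

theorem bwdRank_lt {c c' : Convoy} {m : ℕ} (hm : c.bwd = m + 1) (hm' : c'.bwd = m) :
    c'.bwdRank < c.bwdRank := by
  have h : ¬ c.Improper := fun h => by simp [h.1] at hm
  unfold bwdRank
  rw [if_neg h]
  split <;> omega

/-- The convoy rides until it reaches a given position, runs out of fuel in its forward refueling
subconvoy, or has one tankload of emptiness in its proper backward refueling subconvoy. -/
theorem exists_ride {D : Desert} {c : Convoy} {y : ℝ} (hc : Sound D c) (hr : c.Ready)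
    (hy : FreeRoad D c y)     (hf : 0 < c.fwdFuel) (he : c.Improper ∨ c.emptiness D < 1) :
    ∃ (L f g : ℝ), 0 < L ∧ L ≤ c.pos - y ∧ Step D c (c.arrive D (c.pos - L) f g) ∧
      c.fwdFuel - (2 * c.fwd + 2) * L ≤ f ∧ (g = c.bwdFuel ∨ ¬ c.Improper) ∧
      (L = c.pos - y ∨ f = 0 ∨
        (¬ c.Improper ∧ 2 * c.bwd + D.ringle - g = 1)) := by
  have hL : 0 < c.pos - y := by linarith [hy.2.1]
  have free : ∀ L, 0 < L → L ≤ c.pos - y → FreeRoad D c (c.pos - L) := fun L h1 h2 =>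
    ⟨by linarith [hy.1], by linarith, fun z hz hz' => hy.2.2 z (by linarith) hz'⟩
  have hρ : (0 : ℝ) ≤ D.ringle := Nat.cast_nonneg _
  have hm0 : (0 : ℝ) ≤ c.bwd := Nat.cast_nonneg _
  have hk0 : (0 : ℝ) ≤ c.fwd := Nat.cast_nonneg _
  by_cases hi : c.Improper
  · have hpos : (0 : ℝ) < 2 * c.fwd + 1 + D.ringle := by positivity
    set r : ℝ := 2 * c.fwd + 1 + D.ringle with hrdef
    have hL' : 0 < min (c.pos - y) (c.fwdFuel / r) := lt_min hL (div_pos hf hpos)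
    have h1 := min_le_left (c.pos - y) (c.fwdFuel / r)
    have h2 : r * min (c.pos - y) (c.fwdFuel / r) ≤ c.fwdFuel := by
      calc r * min (c.pos - y) (c.fwdFuel / r) ≤ r * (c.fwdFuel / r) := by
            gcongr; exact min_le_right _ _
        _ = c.fwdFuel := by field_simp
    set L := min (c.pos - y) (c.fwdFuel / r) with hLdef
    have st := Step.rideImproper c (c.pos - L) hr (free L hL' h1) hi
      (by rw [sub_sub_cancel]; exact h2)
    rw [sub_sub_cancel] at st
    refine ⟨L, _, _, hL', h1, st, ?_, Or.inl rfl, ?_⟩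
    · have : (D.ringle : ℝ) * L ≤ 1 * L := by
        gcongr
        rcases D.ringle_eq with h | h <;> simp [h]
      linarith
    · rcases le_total (c.pos - y) (c.fwdFuel / r) with h | h
      · left; rw [hLdef, min_eq_left h]
      · right; left
        rw [← hrdef, hLdef, min_eq_right h]
        field_simp
        ring
  · have he := he.resolve_left hi
    have hq : (0 : ℝ) < 2 * c.bwd + D.ringle := by
      rcases D.ringle_eq with h | h
      · rcases Nat.eq_zero_or_pos c.bwd with h' | h'
        · exact absurd ⟨h', hc.bwdFuel_eq_zero h' h⟩ hi
        · have : (0 : ℝ) < c.bwd := by exact_mod_cast h'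
          positivity
      · rw [h]; positivity
    have hpos : (0 : ℝ) < 2 * c.fwd + 1 := by positivity
    set r : ℝ := 2 * c.fwd + 1 with hrdef
    set q : ℝ := 2 * c.bwd + D.ringle with hqdef
    set L := min (c.pos - y) (min (c.fwdFuel / r) ((1 - c.emptiness D) / q)) with hLdef
    have hL' : 0 < L := lt_min hL (lt_min (div_pos hf hpos) (div_pos (by linarith) hq))
    have h1 : L ≤ c.pos - y := min_le_left _ _
    have h2 : r * L ≤ c.fwdFuel := by
      calc r * L ≤ r * (c.fwdFuel / r) := by
            gcongr; exact (min_le_right _ _).trans (min_le_left _ _)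
        _ = c.fwdFuel := by field_simp
    have h3 : q * L ≤ 1 - c.emptiness D := by
      calc q * L ≤ q * ((1 - c.emptiness D) / q) := by
            gcongr; exact (min_le_right _ _).trans (min_le_right _ _)
        _ = 1 - c.emptiness D := by field_simp
    have st := Step.rideProper c (c.pos - L) hr (free L hL' h1) hi
      (by rw [sub_sub_cancel]; exact h2) (by rw [sub_sub_cancel]; linarith)
    rw [sub_sub_cancel] at st
    refine ⟨L, _, _, hL', h1, st, by linarith, Or.inr hi, ?_⟩
    rcases min_choice (c.pos - y) (min (c.fwdFuel / r) ((1 - c.emptiness D) / q)) with h | h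
    · left; exact h
    right
    rcases min_choice (c.fwdFuel / r) ((1 - c.emptiness D) / q) with h' | h'
    · left
      rw [← hrdef, hLdef, h, h']
      field_simp
      ring
    · right
      refine ⟨hi, ?_⟩
      have : q * L = 1 - c.emptiness D := by
        rw [hLdef, h, h']
        field_simp
      simp only [emptiness] at this
      linarith

/-- Lexicographic induction: `M` bounds `bwdRank`, and `n` is a budget of double jeeps that the
forward subconvoy may still add. A tankload with i double jeeps lasts at least 1/(2i+2), even if it
also feeds a ringle jeep, and the last hypothesis says that the budget covers the remaining
distance. When the rank drops, divergence of the harmonic series provides a fresh budget. -/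
theorem exists_arrival_aux {D : Desert} (y : ℝ) (M : ℕ) : ∀ (n : ℕ) (c : Convoy), Sound D c →
    c.Ready → FreeRoad D c y → c.bwdRank ≤ M →
    c.pos - y ≤ c.fwdFuel / (2 * c.fwd + 2) + (∑ i ∈ Finset.range (c.fwd + 1 + n), 1 / (i + 1 : ℝ) -
      ∑ i ∈ Finset.range (c.fwd + 1), 1 / (i + 1 : ℝ)) / 2 →
    ∃ c', ReflTransGen (Step D) c c' ∧ c'.pos = y := by
  induction M using Nat.strong_induction_on with
  | _ M ihM =>
  have lower : ∀ c : Convoy, Sound D c → c.Ready → FreeRoad D c y → c.bwdRank < M →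
      ∃ c', ReflTransGen (Step D) c c' ∧ c'.pos = y := by
    intro c hc hr hy hM
    have hT := Real.tendsto_sum_range_one_div_nat_succ_atTop
    obtain ⟨K, hK1, hK⟩ := ((Filter.eventually_ge_atTop (c.fwd + 1)).and
      (hT.eventually_ge_atTop (2 * (c.pos - y) +
        ∑ i ∈ Finset.range (c.fwd + 1), 1 / (i + 1 : ℝ)))).exists
    refine ihM _ hM (K - (c.fwd + 1)) c hc hr hy le_rfl ?_
    rw [Nat.add_sub_cancel' hK1]
    have : 0 ≤ c.fwdFuel / (2 * c.fwd + 2) := div_nonneg hc.fwdFuel_nonneg (by positivity)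
    linarith
  have cancel : ∀ c : Convoy, Sound D c → c.Ready → FreeRoad D c y → c.bwdRank ≤ M →
      ¬ c.Improper → c.emptiness D = 1 → ∃ c', ReflTransGen (Step D) c c' ∧ c'.pos = y := by
    intro c hc hr hy hM hi he
    rcases hm : c.bwd with _ | m
    · refine absurd ⟨hm, ?_⟩ hi
      simp only [emptiness, hm] at he
      push_cast at he
      have := hc.bwdFuel_nonneg
      rcases D.ringle_eq with h | h <;> rw [h] at he <;> linarith
    · have st := Step.cancelBackward c m (Or.inl hr) hm he
      obtain ⟨c', h1, h2⟩ := lower _ (st.sound hc) hr hy ((bwdRank_lt hm rfl).trans_le hM)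
      exact ⟨c', .head st h1, h2⟩
  intro n
  induction n using Nat.strong_induction_on with
  | _ n ih =>
  have empty : ∀ c : Convoy, Sound D c → c.Ready → FreeRoad D c y → c.bwdRank ≤ M →
      c.pos - y ≤ c.fwdFuel / (2 * c.fwd + 2) +
        (∑ i ∈ Finset.range (c.fwd + 1 + n), 1 / (i + 1 : ℝ) -
          ∑ i ∈ Finset.range (c.fwd + 1), 1 / (i + 1 : ℝ)) / 2 →
      c.fwdFuel = 0 → ∃ c', ReflTransGen (Step D) c c' ∧ c'.pos = y := by
    intro c hc hr hy hM hL hf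
    -- With no fuel and no budget the distance bound is zero, although `y` is not yet reached.
    rcases n with _ | n
    · simp only [hf, add_zero, sub_self, zero_div] at hL
      linarith [hy.2.1]
    · have st := Step.createForward (D := D) c (Or.inl hr) hf
      obtain ⟨c', h1, h2⟩ := ih n (Nat.lt_succ_self n) _ (st.sound hc) hr hy hM (by
        simp only
        rw [Finset.sum_range_succ _ (c.fwd + 1), show c.fwd + 1 + 1 + n = c.fwd + 1 + (n + 1) by ring]
        rw [hf, zero_div, zero_add] at hL
        push_cast
        have : (1 : ℝ) / (c.fwd + 1 + 1) = 2 * (1 / (2 * (c.fwd + 1) + 2)) := by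
          field_simp
        rw [this]
        linarith)
      exact ⟨c', .head st h1, h2⟩
  intro c hc hr hy hM hL
  rcases hc.fwdFuel_nonneg.eq_or_lt with hf | hf
  · exact empty c hc hr hy hM hL hf.symm
  by_cases he : ¬ c.Improper ∧ c.emptiness D = 1
  · exact cancel c hc hr hy hM he.1 he.2
  have he' : c.Improper ∨ c.emptiness D < 1 := by
    by_cases hi : c.Improper
    · exact Or.inl hi
    · exact Or.inr (lt_of_le_of_ne hc.emptiness_le fun h => he ⟨hi, h⟩)
  obtain ⟨L, f, g, hL0, hL1, st, hfL, hg, hend⟩ := exists_ride hc hr hy hf he'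
  rcases hL1.eq_or_lt with h | h
  · exact ⟨_, .single st, by simp [arrive, h]⟩
  have hc' := st.sound hc
  have hr' : (c.arrive D (c.pos - L) f g).Ready := by
    have := hy.2.2 (c.pos - L) (by linarith) (by linarith)
    refine ⟨by simp [arrive, this.2], by simp [arrive, this.1], ?_⟩
    simp only [arrive]
    linarith [hy.1]
  have hy' : FreeRoad D (c.arrive D (c.pos - L) f g) y :=
    ⟨hy.1, by simp only [arrive]; linarith, fun z h1 h2 => hy.2.2 z h1 (by
      simp only [arrive] at h2; linarith)⟩
  have hM' : (c.arrive D (c.pos - L) f g).bwdRank ≤ c.bwdRank := by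
    by_cases hi : c.Improper
    · have : (c.arrive D (c.pos - L) f g).Improper :=
        ⟨hi.1, by simpa [arrive, hg.resolve_right (not_not.2 hi)] using hi.2⟩
      simp [bwdRank, this]
    · unfold bwdRank
      rw [if_neg hi]
      split <;> simp [arrive]
  rcases hend.resolve_left h.ne with hf0 | he
  · obtain ⟨c', h1, h2⟩ := empty _ hc' hr' hy' (hM'.trans hM) (by
      simp only [arrive]
      have hk : (0 : ℝ) < 2 * c.fwd + 2 := by positivity
      have : c.fwdFuel / (2 * c.fwd + 2) - L ≤ f / (2 * c.fwd + 2) := by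
        rw [div_sub' hk.ne', div_le_div_iff_of_pos_right hk]
        exact hfL
      linarith) hf0
    exact ⟨c', .head st h1, h2⟩
  -- At emptiness one, either only an empty ringle jeep remains, so that the rank falls to zero, or
  -- there is a double jeep to cancel.
  · by_cases hi : (c.arrive D (c.pos - L) f g).Improper
    · obtain ⟨c', h1, h2⟩ := lower _ hc' hr' hy' (by
        refine lt_of_lt_of_le ?_ hM
        simp [bwdRank, hi, he.1])
      exact ⟨c', .head st h1, h2⟩
    · obtain ⟨c', h1, h2⟩ := cancel _ hc' hr' hy' (hM'.trans hM) hi he.2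
      exact ⟨c', .head st h1, h2⟩

/-- The convoy can ride over a free road. -/
theorem exists_arrival {D : Desert} {c : Convoy} {y : ℝ} (hc : Sound D c) (hr : c.Ready)
    (hy : FreeRoad D c y) : ∃ c', ReflTransGen (Step D) c c' ∧ c'.pos = y := by
  obtain ⟨K, hK1, hK⟩ := ((Filter.eventually_ge_atTop (c.fwd + 1)).and
    (Real.tendsto_sum_range_one_div_nat_succ_atTop.eventually_ge_atTop (2 * (c.pos - y) +
      ∑ i ∈ Finset.range (c.fwd + 1), 1 / (i + 1 : ℝ)))).exists
  refine exists_arrival_aux y _ (K - (c.fwd + 1)) c hc hr hy le_rfl ?_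
  rw [Nat.add_sub_cancel' hK1]
  have : 0 ≤ c.fwdFuel / (2 * c.fwd + 2) := div_nonneg hc.fwdFuel_nonneg (by positivity)
  linarith

/-- Induction on the number of depot positions still ahead: the convoy settles, then rides to the
largest of them, or to the border if there is none. -/
theorem exists_border {D : Desert} (n : ℕ) (c : Convoy) (hc : Sound D c)
    (hn : ((D.supply.support ∪ D.demand.support).filter (· < c.pos)).card ≤ n) :
    ∃ c', ReflTransGen (Step D) c c' ∧ c'.pos = 0 := by
  induction n generalizing c with
  | zero =>
    obtain ⟨c1, r1, p1, d1, s1⟩ := exists_settled c hc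
    rcases hc.pos_nonneg.eq_or_lt with h0 | h0
    · exact ⟨c, .refl, h0.symm⟩
    obtain ⟨c2, r2, p2⟩ := exists_arrival (y := 0) (sound_of_reflTransGen r1 hc)
      ⟨d1, s1, p1 ▸ h0⟩ ⟨le_rfl, p1 ▸ h0, fun z _ hz => by
        rw [Nat.le_zero, Finset.card_eq_zero] at hn
        by_contra h
        have : z ∈ (D.supply.support ∪ D.demand.support).filter (· < c.pos) := by
          rw [Finset.mem_filter, Finset.mem_union, Finsupp.mem_support_iff, Finsupp.mem_support_iff]
          exact ⟨by tauto, p1 ▸ hz⟩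
        simp [hn] at this⟩
    exact ⟨c2, r1.trans r2, p2⟩
  | succ n ih =>
    set s := (D.supply.support ∪ D.demand.support).filter (· < c.pos) with hs
    rcases s.eq_empty_or_nonempty with he | hne
    · exact ih c hc (by rw [← hs, he]; simp)
    have hmem := s.max'_mem hne
    set y := s.max' hne with hy
    rw [hs, Finset.mem_filter, Finset.mem_union] at hmem
    have hy0 : 0 < y := hmem.1.elim (fun h => (D.supply_mem y h).1) fun h => (D.demand_mem y h).1
    obtain ⟨c1, r1, p1, d1, s1⟩ := exists_settled c hc
    obtain ⟨c2, r2, p2⟩ := exists_arrival (y := y) (sound_of_reflTransGen r1 hc)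
      ⟨d1, s1, p1 ▸ hy0.trans hmem.2⟩ ⟨hy0.le, p1 ▸ hmem.2, fun z hz hz' => by
        by_contra h
        have : z ∈ s := by
          rw [hs, Finset.mem_filter, Finset.mem_union, Finsupp.mem_support_iff,
            Finsupp.mem_support_iff]
          exact ⟨by tauto, p1 ▸ hz'⟩
        exact absurd (s.le_max' z this) (not_le.2 hz)⟩
    obtain ⟨c3, r3, p3⟩ := ih c2 (sound_of_reflTransGen (r1.trans r2) hc) (by
      refine Nat.le_of_lt_succ ((Finset.card_lt_card ?_).trans_le hn)
      refine Finset.ssubset_iff_of_subset (fun z hz => ?_) |>.2 ⟨y, ?_, ?_⟩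
      · rw [Finset.mem_filter] at hz
        exact Finset.mem_filter.2 ⟨hz.1, hz.2.trans (p2 ▸ hmem.2)⟩
      · exact s.max'_mem hne
      · simp [p2])
    exact ⟨c3, (r1.trans r2).trans r3, p3⟩

end Convoy

theorem exists_isConvoyAlgorithm (D : Desert) : ∃ T c, IsConvoyAlgorithm D T c := by
  obtain ⟨c, hr, hp⟩ := Convoy.exists_border _ (Convoy.start D) (Convoy.sound_start D) le_rfl
  obtain ⟨T, h1, h2⟩ := List.exists_isChain_cons_of_relationReflTransGen hr
  exact ⟨_ :: T, c, rfl, h1, by rw [List.getLast?_eq_some_getLast (by simp), h2], hp⟩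

end FineJeep

/-! ### Fuel flow in a single jeep step -/

namespace FineJeep

/-- The fuel at `x`: in the depot and in the tank of the jeep. -/
noncomputable def JeepState.content (s : JeepState) (x : ℝ) : ℝ :=
  s.depot x + if s.pos = x then s.tank else 0

/-- The fuel that is carried in forward direction over a position just after `y`. -/
noncomputable def flowAfter (y : ℝ) (s t : JeepState) : ℝ :=
  if s.pos ≤ y ∧ y < t.pos then s.tank - (y - s.pos)
  else if t.pos ≤ y ∧ y < s.pos then -(s.tank - (s.pos - y)) else 0

/-- The fuel that is carried in forward direction over a position just before `x`. -/
noncomputable def flowBefore (x : ℝ) (s t : JeepState) : ℝ :=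
  if s.pos < x ∧ x ≤ t.pos then s.tank - (x - s.pos)
  else if t.pos < x ∧ x ≤ s.pos then -(s.tank - (s.pos - x)) else 0

/-- The number of forward passages over the interval from `y` to `x`. -/
noncomputable def ups (y x : ℝ) (s t : JeepState) : ℕ :=
  if s.pos ≤ y ∧ x ≤ t.pos then 1 else 0

/-- The number of backward passages over the interval from `y` to `x`. -/
noncomputable def downs (y x : ℝ) (s t : JeepState) : ℕ :=
  if x ≤ s.pos ∧ t.pos ≤ y then 1 else 0

/-- The physical bounds on the state of the jeep. -/
structure JeepState.Sound (D : Desert) (s : JeepState) : Prop where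
  pos_nonneg : 0 ≤ s.pos
  pos_le : s.pos ≤ D.oasis
  tank_nonneg : 0 ≤ s.tank
  tank_le : s.tank ≤ 1
  depot_nonneg : ∀ x, 0 ≤ s.depot x

theorem JeepState.sound_start (D : Desert) : (JeepState.start D).Sound D where
  pos_nonneg := le_rfl
  pos_le := D.oasis_pos.le
  tank_nonneg := le_rfl
  tank_le := zero_le_one
  depot_nonneg _ := NNReal.coe_nonneg _

namespace JeepStep

variable {D : Desert} {s t : JeepState}

theorem sound (h : JeepStep D s t) (hs : s.Sound D) : t.Sound D := by
  obtain ⟨h1, h2, h3, h4, h5⟩ := hs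
  cases h with
  | ride y h0 h1' h =>
    exact ⟨h0, h1', by simp only; linarith, by simp only; linarith [abs_nonneg (y - s.pos)], h5⟩
  | load u h0 h1' h =>
    refine ⟨h1, h2, by simp only; linarith, h, fun x => ?_⟩
    rcases eq_or_ne x s.pos with rfl | hx
    · simpa using h1'
    · simpa [hx] using h5 x
  | unload u h0 h1' =>
    refine ⟨h1, h2, by simp only; linarith, by simp only; linarith, fun x => ?_⟩
    rcases eq_or_ne x s.pos with rfl | hx
    · simpa using add_nonneg (h5 s.pos) h0
    · simpa [hx] using h5 x
  | takeAtBorder u hp h0 h => exact ⟨h1, h2, by simp only; linarith, h, h5⟩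
  | returnAtBorder u ha hp h0 h =>
    exact ⟨h1, h2, by simp only; linarith, by simp only; linarith, h5⟩

/-- Conservation of fuel at one point: consumption happens between points, and `x ≠ 0` excludes
trade at the border. -/
theorem flowBefore_eq (h : JeepStep D s t) {x : ℝ} (hx : x ≠ 0) :
    flowBefore x s t = flowAfter x s t + t.content x - s.content x := by
  cases h with
  | ride y h0 h1' h =>
    simp only [flowBefore, flowAfter, JeepState.content]
    rcases abs_cases (y - s.pos) with ⟨ha, ha'⟩ | ⟨ha, ha'⟩ <;> rw [ha] <;>
      rcases lt_or_ge s.pos x with h1 | h1 <;> rcases lt_or_ge y x with h2 | h2 <;>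
      split_ifs <;> grind
  | load u h0 h1' h =>
    rcases eq_or_ne x s.pos with rfl | hx
    · simp [flowBefore, flowAfter, JeepState.content]
    · simp [flowBefore, flowAfter, JeepState.content, hx, hx.symm]
      split_ifs <;> linarith
  | unload u h0 h1' =>
    rcases eq_or_ne x s.pos with rfl | hx
    · simp [flowBefore, flowAfter, JeepState.content]
    · simp [flowBefore, flowAfter, JeepState.content, hx, hx.symm]
      split_ifs <;> linarith
  | takeAtBorder u hp h0 h =>
    simp only [flowBefore, flowAfter, JeepState.content, hp]
    split_ifs <;> grind
  | returnAtBorder u ha hp h0 h =>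
    simp only [flowBefore, flowAfter, JeepState.content, hp]
    split_ifs <;> grind

theorem used_eq (h : JeepStep D s t) (hs : s.Sound D) :
    t.used - s.used = flowAfter 0 s t + t.content 0 - s.content 0 := by
  have hp := hs.pos_nonneg
  cases h with
  | ride y h0 h1' h =>
    simp only [flowAfter, JeepState.content]
    rcases abs_cases (y - s.pos) with ⟨ha, ha'⟩ | ⟨ha, ha'⟩ <;> rw [ha] <;>
    rcases hp.eq_or_lt with h1 | h1 <;> rcases h0.eq_or_lt with h2 | h2 <;>
      split_ifs <;> grind
  | load u h0 h1' h =>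
    simp only [flowAfter, JeepState.content, Function.update_apply]
    split_ifs <;> grind
  | unload u h0 h1' =>
    simp only [flowAfter, JeepState.content, Function.update_apply]
    split_ifs <;> grind
  | takeAtBorder u hp h0 h =>
    simp only [flowAfter, JeepState.content, hp]
    split_ifs <;> grind
  | returnAtBorder u ha hp h0 h =>
    simp only [flowAfter, JeepState.content, hp]
    split_ifs <;> grind

theorem dist_le_tank (h : JeepStep D s t) (hs : s.Sound D) : |t.pos - s.pos| ≤ s.tank := by
  have := hs.tank_nonneg
  cases h <;> simp_all

/-- A ride that neither starts nor ends inside the interval crosses it completely or not at all, and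
a complete crossing burns `x - y` in either direction. -/
theorem flowAfter_eq_gap {s t : JeepState} {y x : ℝ} (hyx : y < x)
    (h1 : s.pos ≤ y ∨ x ≤ s.pos) (h2 : t.pos ≤ y ∨ x ≤ t.pos) :
    flowAfter y s t = flowBefore x s t + (ups y x s t + downs y x s t : ℕ) * (x - y) := by
  rcases h1 with h1 | h1 <;> rcases h2 with h2 | h2
  · have e1 : ¬ y < s.pos := by linarith
    have e2 : ¬ y < t.pos := by linarith
    have e3 : ¬ x ≤ s.pos := by linarith
    have e4 : ¬ x ≤ t.pos := by linarith
    simp [flowAfter, flowBefore, ups, downs, e1, e2, e3, e4]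
  · have e1 : y < t.pos := by linarith
    have e2 : s.pos < x := by linarith
    have e3 : ¬ x ≤ s.pos := by linarith
    simp [flowAfter, flowBefore, ups, downs, e1, e2, e3, h1, h2]
    ring
  · have e1 : y < s.pos := by linarith
    have e2 : t.pos < x := by linarith
    have e3 : ¬ s.pos ≤ y := by linarith
    have e4 : ¬ s.pos < x := by linarith
    simp [flowAfter, flowBefore, ups, downs, e1, e2, e3, e4, h1, h2]
    ring
  · have e1 : ¬ s.pos ≤ y := by linarith
    have e2 : ¬ t.pos ≤ y := by linarith
    have e3 : ¬ s.pos < x := by linarith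
    have e4 : ¬ t.pos < x := by linarith
    simp [flowAfter, flowBefore, ups, downs, e1, e2, e3, e4]

theorem flowAfter_le_ups (h : JeepStep D s t) (hs : s.Sound D) {y x : ℝ}
    (h2 : t.pos ≤ y ∨ x ≤ t.pos) : flowAfter y s t ≤ ups y x s t := by
  have h3 := hs.tank_le
  have h4 := abs_le.1 (h.dist_le_tank hs)
  simp only [flowAfter, ups]
  split_ifs <;> push_cast <;> first | linarith | grind

theorem neg_downs_le_flowAfter (h : JeepStep D s t) (hs : s.Sound D) {y x : ℝ}
    (h1 : s.pos ≤ y ∨ x ≤ s.pos) : -(downs y x s t : ℝ) ≤ flowAfter y s t := by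
  have h3 := hs.tank_le
  have h4 := abs_le.1 (h.dist_le_tank hs)
  simp only [flowAfter, downs]
  split_ifs <;> push_cast <;> first | linarith | grind

theorem ups_sub_downs {y x : ℝ} (hyx : y < x)
    (h1 : s.pos ≤ y ∨ x ≤ s.pos) (h2 : t.pos ≤ y ∨ x ≤ t.pos) :
    ups y x s t + (if x ≤ s.pos then 1 else 0) = downs y x s t + if x ≤ t.pos then 1 else 0 := by
  simp only [ups, downs]
  split_ifs <;> grind

theorem flowBefore_nonpos (h : JeepStep D s t) (hs : s.Sound D) {x : ℝ} (hx : t.pos < x) :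
    flowBefore x s t ≤ 0 := by
  have h4 := abs_le.1 (h.dist_le_tank hs)
  simp only [flowBefore]
  split_ifs <;> linarith

theorem flowBefore_nonneg (h : JeepStep D s t) (hs : s.Sound D) {x : ℝ} (hx : s.pos < x) :
    0 ≤ flowBefore x s t := by
  have h4 := abs_le.1 (h.dist_le_tank hs)
  simp only [flowBefore]
  split_ifs <;> linarith

end JeepStep
end FineJeep

/-! ### Fuel flow over a whole trip -/

namespace FineJeep

/-- The states `st 0`, …, `st N` are those of a normal algorithm. -/
structure Trip (D : Desert) (st : ℕ → JeepState) (N : ℕ) : Prop where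
  start : st 0 = JeepState.start D
  step : ∀ i < N, JeepStep D (st i) (st (i + 1))
  visits : ∃ i ≤ N, (st i).pos = D.oasis
  ends : (st N).pos = if D.roundTrip then 0 else D.oasis

/-- The net amount of fuel carried forward over a position just after `y`, before time `n`. -/
noncomputable def netAfter (st : ℕ → JeepState) (y : ℝ) (n : ℕ) : ℝ :=
  ∑ i ∈ Finset.range n, flowAfter y (st i) (st (i + 1))

/-- The net amount of fuel carried forward over a position just before `x`, before time `n`. -/
noncomputable def netBefore (st : ℕ → JeepState) (x : ℝ) (n : ℕ) : ℝ :=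
  ∑ i ∈ Finset.range n, flowBefore x (st i) (st (i + 1))

/-- The number of forward passages over the interval from `y` to `x`, before time `n`. -/
noncomputable def upsTo (st : ℕ → JeepState) (y x : ℝ) (n : ℕ) : ℕ :=
  ∑ i ∈ Finset.range n, ups y x (st i) (st (i + 1))

/-- The number of backward passages over the interval from `y` to `x`, before time `n`. -/
noncomputable def downsTo (st : ℕ → JeepState) (y x : ℝ) (n : ℕ) : ℕ :=
  ∑ i ∈ Finset.range n, downs y x (st i) (st (i + 1))

theorem upsTo_mono (st : ℕ → JeepState) (y x : ℝ) : Monotone (upsTo st y x) :=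
  fun _ _ h => Finset.sum_le_sum_of_subset (Finset.range_subset_range.2 h)

namespace Trip

variable {D : Desert} {st : ℕ → JeepState} {N : ℕ}

theorem sound (h : Trip D st N) {n : ℕ} (hn : n ≤ N) : (st n).Sound D := by
  induction n with
  | zero => rw [h.start]; exact JeepState.sound_start D
  | succ n ih => exact (h.step n hn).sound (ih (Nat.le_of_succ_le hn))

theorem netBefore_add_supply (h : Trip D st N) {x : ℝ} (hx : 0 < x) {n : ℕ} (hn : n ≤ N) :
    netBefore st x n + D.supply x = netAfter st x n + (st n).content x := by
  induction n with
  | zero => simp [netBefore, netAfter, h.start, JeepState.content, JeepState.start]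
  | succ n ih =>
    have := (h.step n hn).flowBefore_eq hx.ne'
    have ih := ih (Nat.le_of_succ_le hn)
    simp only [netBefore, netAfter, Finset.sum_range_succ] at *
    linarith

theorem used_eq (h : Trip D st N) {n : ℕ} (hn : n ≤ N) :
    (st n).used = netAfter st 0 n + (st n).content 0 := by
  induction n with
  | zero =>
    simp [netAfter, h.start, JeepState.content, JeepState.start,
      D.supply_eq_zero (Or.inl le_rfl)]
  | succ n ih =>
    have := (h.step n hn).used_eq (h.sound (Nat.le_of_succ_le hn))
    have ih := ih (Nat.le_of_succ_le hn)
    simp only [netAfter, Finset.sum_range_succ] at *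
    linarith

theorem content_nonneg (h : Trip D st N) {n : ℕ} (hn : n ≤ N) (x : ℝ) :
    (st n).depot x ≤ (st n).content x ∧ 0 ≤ (st n).content x := by
  have h1 := (h.sound hn).depot_nonneg x
  have h2 := (h.sound hn).tank_nonneg
  unfold JeepState.content
  split_ifs <;> constructor <;> linarith

/-- At the first moment when the jeep is at or beyond `x`, nothing has been carried back yet. -/
theorem exists_netBefore_nonneg (h : Trip D st N) {x : ℝ} (hxd : x ≤ D.oasis) :
    ∃ n ≤ N, x ≤ (st n).pos ∧ 0 ≤ netBefore st x n := by
  classical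
  obtain ⟨i, hi, hpi⟩ := h.visits
  have hex : ∃ n, x ≤ (st n).pos := ⟨i, by rw [hpi]; exact hxd⟩
  have hle : Nat.find hex ≤ N := (Nat.find_min' hex (by rw [hpi]; exact hxd)).trans hi
  refine ⟨Nat.find hex, hle, Nat.find_spec hex, Finset.sum_nonneg fun j hj => ?_⟩
  have hj := Finset.mem_range.1 hj
  exact (h.step j (hj.trans_le hle)).flowBefore_nonneg (h.sound (hj.trans_le hle).le)
    (not_le.1 (Nat.find_min hex hj))

/-- After the last moment at or beyond `x` nothing is carried forward over `x`, so the net amount at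
that moment is at least the final one. -/
theorem exists_netBefore_ge (h : Trip D st N) {x : ℝ} (hxd : x ≤ D.oasis) :
    ∃ n ≤ N, x ≤ (st n).pos ∧ netBefore st x N ≤ netBefore st x n := by
  have key : ∀ n ≤ N, (∃ i ≤ n, x ≤ (st i).pos) →
      ∃ i ≤ n, x ≤ (st i).pos ∧ netBefore st x n ≤ netBefore st x i := by
    intro n
    induction n with
    | zero =>
      rintro - ⟨i, hi, hx⟩
      obtain rfl := Nat.le_zero.1 hi
      exact ⟨0, le_rfl, hx, le_rfl⟩
    | succ n ih =>
      rintro hn ⟨i, hi, hx⟩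
      rcases le_or_gt x (st (n + 1)).pos with hp | hp
      · exact ⟨n + 1, le_rfl, hp, le_rfl⟩
      have hi' : i ≤ n := by
        rcases Nat.le_succ_iff.1 hi with h | rfl
        · exact h
        · exact absurd hx (not_le.2 hp)
      obtain ⟨j, hj, hxj, hnj⟩ := ih (Nat.le_of_succ_le hn) ⟨i, hi', hx⟩
      refine ⟨j, hj.trans (Nat.le_succ n), hxj, le_trans ?_ hnj⟩
      have := (h.step n hn).flowBefore_nonpos (h.sound (Nat.le_of_succ_le hn)) hp
      simp only [netBefore, Finset.sum_range_succ]
      linarith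
  obtain ⟨i, hi, hpi⟩ := h.visits
  exact key N le_rfl ⟨i, hi, by rw [hpi]; exact hxd⟩

theorem netAfter_le_upsTo (h : Trip D st N) {y x : ℝ}
    (hgap : ∀ i ≤ N, (st i).pos ≤ y ∨ x ≤ (st i).pos) {n : ℕ} (hn : n ≤ N) :
    netAfter st y n ≤ upsTo st y x n := by
  unfold netAfter upsTo
  push_cast
  refine Finset.sum_le_sum fun i hi => ?_
  have hi : i < N := (Finset.mem_range.1 hi).trans_le hn
  exact (h.step i hi).flowAfter_le_ups (h.sound hi.le) (hgap (i + 1) hi)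

theorem netAfter_sub_le_downsTo (h : Trip D st N) {y x : ℝ}
    (hgap : ∀ i ≤ N, (st i).pos ≤ y ∨ x ≤ (st i).pos) {n : ℕ} (hn : n ≤ N) :
    netAfter st y n - netAfter st y N ≤ downsTo st y x N - (downsTo st y x n : ℝ) := by
  have key : ∀ k, n + k ≤ N → netAfter st y n - netAfter st y (n + k) ≤
      downsTo st y x (n + k) - (downsTo st y x n : ℝ) := by
    intro k
    induction k with
    | zero => intro; simp
    | succ k ih =>
      intro hk
      have := (h.step (n + k) hk).neg_downs_le_flowAfter (h.sound (by omega))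
        (hgap (n + k) (by omega))
      have ih := ih (by omega)
      simp only [netAfter, downsTo, ← add_assoc, Finset.sum_range_succ] at *
      push_cast at *
      linarith
  have := key (N - n) (by omega)
  rwa [Nat.add_sub_cancel' hn] at this

theorem netAfter_eq_gap {y x : ℝ} (hyx : y < x)
    (hgap : ∀ i ≤ N, (st i).pos ≤ y ∨ x ≤ (st i).pos) {n : ℕ} (hn : n ≤ N) :
    netAfter st y n =
    netBefore st x n + (upsTo st y x n + downsTo st y x n : ℕ) * (x - y) := by
  simp only [netAfter, netBefore, upsTo, downsTo, ← Finset.sum_add_distrib]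
  push_cast
  rw [Finset.sum_mul, ← Finset.sum_add_distrib]
  refine Finset.sum_congr rfl fun i hi => ?_
  have hi : i < N := (Finset.mem_range.1 hi).trans_le hn
  have := JeepStep.flowAfter_eq_gap hyx (hgap i hi.le) (hgap (i + 1) hi)
  push_cast at this
  exact this

theorem upsTo_eq (h : Trip D st N) {y x : ℝ} (hyx : y < x)
    (hgap : ∀ i ≤ N, (st i).pos ≤ y ∨ x ≤ (st i).pos) (hy : 0 ≤ y) {n : ℕ} (hn : n ≤ N) :
    upsTo st y x n = downsTo st y x n + if x ≤ (st n).pos then 1 else 0 := by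
  induction n with
  | zero =>
    have : ¬ x ≤ (st 0).pos := by
      rw [h.start]
      simp only [JeepState.start]
      linarith
    simp [upsTo, downsTo, this]
  | succ n ih =>
    have ih := ih (Nat.le_of_succ_le hn)
    have := JeepStep.ups_sub_downs hyx (hgap n (Nat.le_of_succ_le hn)) (hgap (n + 1) hn)
    simp only [upsTo, downsTo, Finset.sum_range_succ] at *
    omega

/-- The fuel needed just after `y` is bounded below by the fuel needed just before `x` and the
consumption between `y` and `x`, if the jeep does not stop between `y` and `x`. -/
theorem ride_gap (h : Trip D st N) {y x α ν : ℝ} {k m : ℕ} (hy : 0 ≤ y) (hyx : y < x)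
    (hxd : x ≤ D.oasis) (hgap : ∀ i ≤ N, (st i).pos ≤ y ∨ x ≤ (st i).pos)
    (hk : (k : ℝ) ≤ α) (hα : ∃ n ≤ N, x ≤ (st n).pos ∧ α ≤ netBefore st x n)
    (hν : ν ≤ netBefore st x N)
    (hm : m = 0 ∨ (m + D.ringle - 1 : ℝ) ≤ α + (2 * k + 1) * (x - y) -
      (ν + (2 * k + 1 + 2 * m + D.ringle) * (x - y))) :
    (∃ n ≤ N, y ≤ (st n).pos ∧ α + (2 * k + 1) * (x - y) ≤ netAfter st y n) ∧
      ν + (2 * k + 1 + 2 * m + D.ringle) * (x - y) ≤ netAfter st y N := by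
  obtain ⟨n, hn, hxn, hαn⟩ := hα
  have hh : 0 < x - y := by linarith
  have e1 := h.upsTo_eq hyx hgap hy hn
  rw [if_pos hxn] at e1
  have e2 := h.upsTo_eq hyx hgap hy (le_refl N)
  have g1 := netAfter_eq_gap hyx hgap hn
  have g2 := netAfter_eq_gap hyx hgap (le_refl N)
  have b1 := h.netAfter_le_upsTo hgap hn
  have b2 := h.netAfter_sub_le_downsTo hgap hn
  have mono := upsTo_mono st y x hn
  -- At least one passage has burned a positive amount, so the net amount just after `y` strictly
  -- exceeds `k`; with one tankload per forward passage, `k` passages are too few.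
  have hup : k + 1 ≤ upsTo st y x n := by
    have h1 : (1 : ℝ) ≤ (upsTo st y x n + downsTo st y x n : ℕ) := by
      exact_mod_cast (by omega : 1 ≤ upsTo st y x n + downsTo st y x n)
    have h2 : (k : ℝ) < upsTo st y x n := by nlinarith
    exact_mod_cast h2
  have hA : α + (2 * k + 1) * (x - y) ≤ netAfter st y n := by
    have h1 : (2 * k + 1 : ℝ) ≤ (upsTo st y x n + downsTo st y x n : ℕ) := by
      exact_mod_cast (by omega : 2 * k + 1 ≤ upsTo st y x n + downsTo st y x n)
    rw [g1]
    gcongr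
  refine ⟨⟨n, hn, hyx.le.trans hxn, hA⟩, ?_⟩
  by_contra hcon
  push Not at hcon
  have hend : upsTo st y x N + D.ringle = downsTo st y x N + 1 := by
    rw [e2, h.ends, Desert.ringle]
    split_ifs <;> first | omega | linarith
  -- By `hcon`, more than m + ρ - 1 is returned after time `n`, at most one tankload per passage;
  -- integrality gives m + ρ passages. For m = 0, the ρ passages follow from where the trip ends.
  have hdown : downsTo st y x n + m + D.ringle ≤ downsTo st y x N := by
    rcases hm with rfl | hm
    · omega
    · have h1 : (downsTo st y x n + m + D.ringle : ℝ) < downsTo st y x N + 1 := by linarith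
      have h2 : downsTo st y x n + m + D.ringle < downsTo st y x N + 1 := by exact_mod_cast h1
      omega
  have htot : (2 * k + 1 + 2 * m + D.ringle : ℝ) ≤ (upsTo st y x N + downsTo st y x N : ℕ) := by
    exact_mod_cast (by omega : 2 * k + 1 + 2 * m + D.ringle ≤
      upsTo st y x N + downsTo st y x N)
  have := mul_le_mul_of_nonneg_right htot hh.le
  linarith

/-- Induction on the number of stops inside the interval. A stop `z` splits it into parts with fewer
stops and the same `k` and `m`. Since `z` has no supply, the flow before `z` is at least the flow
after it; the condition on `m` passes to both parts because consumption only weakens the return. -/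
theorem ride (h : Trip D st N) {k m : ℕ} (c : ℕ) : ∀ {y x α ν : ℝ}, 0 ≤ y → y < x →
    x ≤ D.oasis → (∀ z, y < z → z < x → D.supply z = 0) →
    (((Finset.range (N + 1)).filter fun i => y < (st i).pos ∧ (st i).pos < x).card ≤ c) →
    (k : ℝ) ≤ α → (∃ n ≤ N, x ≤ (st n).pos ∧ α ≤ netBefore st x n) → ν ≤ netBefore st x N →
    (m = 0 ∨ (m + D.ringle - 1 : ℝ) ≤ α + (2 * k + 1) * (x - y) -
      (ν + (2 * k + 1 + 2 * m + D.ringle) * (x - y))) →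
    (∃ n ≤ N, y ≤ (st n).pos ∧ α + (2 * k + 1) * (x - y) ≤ netAfter st y n) ∧
      ν + (2 * k + 1 + 2 * m + D.ringle) * (x - y) ≤ netAfter st y N := by
  induction c with
  | zero =>
    intro y x α ν hy hyx hxd hfree hc hk hα hν hm
    refine h.ride_gap hy hyx hxd (fun i hi => ?_) hk hα hν hm
    rw [Nat.le_zero, Finset.card_eq_zero, Finset.filter_eq_empty_iff] at hc
    have := hc (Finset.mem_range.2 (Nat.lt_succ_of_le hi))
    by_contra hcon
    push Not at hcon
    exact this hcon
  | succ c ih =>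
    intro y x α ν hy hyx hxd hfree hc hk hα hν hm
    rcases ((Finset.range (N + 1)).filter
      fun i => y < (st i).pos ∧ (st i).pos < x).eq_empty_or_nonempty with he | ⟨i, hi⟩
    · exact ih hy hyx hxd hfree (by rw [he]; simp) hk hα hν hm
    have hi' := (Finset.mem_filter.1 hi).2
    set z := (st i).pos with hz
    have hz0 : 0 < z := hy.trans_lt hi'.1
    have ssub : ∀ p q : ℝ, y ≤ p → q ≤ x → (z ≤ p ∨ q ≤ z) →
        ((Finset.range (N + 1)).filter fun i => p < (st i).pos ∧ (st i).pos < q).card ≤ c := by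
      intro p q hp hq hpq
      refine Nat.le_of_lt_succ ((Finset.card_lt_card ?_).trans_le hc)
      refine Finset.ssubset_iff_of_subset (fun j hj => ?_) |>.2 ⟨i, hi, fun hj => ?_⟩
      · rw [Finset.mem_filter] at hj ⊢
        exact ⟨hj.1, hp.trans_lt hj.2.1, hj.2.2.trans_le hq⟩
      · have hj := (Finset.mem_filter.1 hj).2
        rcases hpq with h | h <;> linarith [hj.1, hj.2]
    have hk0 : (0 : ℝ) ≤ k := Nat.cast_nonneg k
    have hρ0 : (0 : ℝ) ≤ D.ringle := Nat.cast_nonneg _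
    have hm0 : (0 : ℝ) ≤ m := Nat.cast_nonneg _
    have q1 : 0 ≤ (2 * k + 1 : ℝ) * (x - z) := mul_nonneg (by positivity) (by linarith [hi'.2])
    have q2 : 0 ≤ (2 * m + D.ringle : ℝ) * (z - y) :=
      mul_nonneg (by positivity) (by linarith [hi'.1])
    obtain ⟨⟨n, hn, hzn, hAn⟩, hN⟩ := ih (y := z) (x := x) hz0.le hi'.2 hxd
      (fun w hw => hfree w (hi'.1.trans hw)) (ssub z x hi'.1.le le_rfl (Or.inl le_rfl)) hk hα hν
      (hm.imp_right fun hm => by linarith)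
    have before : ∀ n ≤ N, netAfter st z n ≤ netBefore st z n := by
      intro n hn
      have h1 := h.netBefore_add_supply hz0 hn
      rw [hfree z hi'.1 hi'.2] at h1
      have := (h.content_nonneg hn z).2
      simp only [NNReal.coe_zero] at h1
      linarith
    obtain ⟨⟨n', hn', hyn', hAn'⟩, hN'⟩ := ih (y := y) (x := z) hy hi'.1 (hi'.2.le.trans hxd)
      (fun w hw hw' => hfree w hw (hw'.trans hi'.2)) (ssub y z le_rfl hi'.2.le (Or.inr le_rfl))
      (by linarith) ⟨n, hn, hzn, hAn.trans (before n hn)⟩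
      (hN.trans (before N le_rfl)) (hm.imp_right fun hm => by linarith)
    exact ⟨⟨n', hn', hyn', by linarith⟩, by linarith⟩

end Trip

/-! ### The convoy bounds every trip from below -/

/-- The fuel that the trip needs at the position of the convoy is at least that of the convoy. -/
structure Dominates (D : Desert) (st : ℕ → JeepState) (N : ℕ) (c : Convoy) : Prop where
  outward : 0 < c.pos → ∃ n ≤ N, c.pos ≤ (st n).pos ∧ c.outward - c.stock ≤ netBefore st c.pos n
  total : 0 < c.pos → c.outward - c.homeward + c.due - c.stock ≤ netBefore st c.pos N
  border : c.pos = 0 → (∃ n ≤ N, c.outward ≤ netAfter st 0 n) ∧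
    c.outward - c.homeward ≤ netAfter st 0 N

variable {D : Desert} {st : ℕ → JeepState} {N : ℕ}

theorem Trip.dominates_start (h : Trip D st N) (hd : ∀ x, (D.demand x : ℝ) ≤ (st N).depot x) :
    Dominates D st N (Convoy.start D) where
  outward _ := by
    obtain ⟨n, hn, hp, h0⟩ := h.exists_netBefore_nonneg (le_refl D.oasis)
    refine ⟨n, hn, hp, le_trans ?_ h0⟩
    simp [Convoy.outward, Convoy.start]
  total _ := by
    have h1 := h.netBefore_add_supply D.oasis_pos (le_refl N)
    have h2 := (h.content_nonneg (le_refl N) D.oasis).1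
    have h3 : netAfter st D.oasis N = 0 := by
      refine Finset.sum_eq_zero fun i hi => ?_
      have hi := Finset.mem_range.1 hi
      have p1 := (h.sound hi.le).pos_le
      have p2 := (h.sound (Nat.succ_le_of_lt hi)).pos_le
      simp [flowAfter, not_lt.2 p1, not_lt.2 p2]
    have h4 := hd D.oasis
    simp only [Convoy.outward, Convoy.homeward, Convoy.start]
    push_cast
    linarith
  border h := absurd h D.oasis_pos.ne'

/-- The condition `hm` says that the emptiness on arrival is at most one. An improper convoy uses `m
= 0`, and its ringle jeep's consumption counts as `outward`. -/
theorem Trip.dominates_arrive (h : Trip D st N) (hdem : ∀ x, (D.demand x : ℝ) ≤ (st N).depot x)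
    {c : Convoy} (hc : c.Sound D) (hr : c.Ready) (hdom : Dominates D st N c) {y f g : ℝ}
    (hy : Convoy.FreeRoad D c y) {m : ℕ}
    (hm : m = 0 ∨ (m + D.ringle - 1 : ℝ) ≤ c.homeward - (2 * m + D.ringle) * (c.pos - y))
    (hf : f = c.fwdFuel - (2 * c.fwd + 1) * (c.pos - y) ∨ g - c.bwd = 0)
    (hν : c.fwd + 1 - f - (g - c.bwd) =
      c.outward - c.homeward + (2 * c.fwd + 1 + 2 * m + D.ringle) * (c.pos - y)) :
    Dominates D st N (c.arrive D y f g) := by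
  obtain ⟨hd, hs, hx⟩ := hr
  obtain ⟨h1, h2, -⟩ := hdom
  have h1 := h1 hx
  have h2 := h2 hx
  rw [hd, hs] at h2
  rw [hs] at h1
  obtain ⟨⟨n, hn, hyn, hA⟩, hN⟩ := h.ride (k := c.fwd) (m := m) (α := c.outward)
    (ν := c.outward - c.homeward) _ hy.1 hy.2.1 hc.pos_le
    (fun z hz hz' => (hy.2.2 z hz hz').1) le_rfl
    (by have := hc.fwdFuel_le; simp only [Convoy.outward]; linarith) (by simpa using h1)
    (by linarith) (hm.imp_right fun hm => by linarith)
  rw [← hν] at hN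
  have hyd : y ≤ D.oasis := hy.2.1.le.trans hc.pos_le
  have after : 0 < y → ∀ n ≤ N, netAfter st y n - D.supply y ≤ netBefore st y n := fun h0 n hn => by
    have h3 := h.netBefore_add_supply h0 hn
    have := (h.content_nonneg hn y).2
    linarith
  have final : 0 < y → netAfter st y N + D.demand y - D.supply y ≤ netBefore st y N := fun h0 => by
    have h3 := h.netBefore_add_supply h0 le_rfl
    have := (h.content_nonneg le_rfl y).1
    linarith [hdem y]
  have hb : (0 : ℝ) ≤ D.demand y := NNReal.coe_nonneg _
  refine ⟨fun h0 => ?_, fun h0 => ?_, fun h0 => ?_⟩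
  · rcases hf with hf | hf
    · refine ⟨n, hn, hyn, le_trans ?_ (after h0 n hn)⟩
      simp only [Convoy.outward, Convoy.arrive] at hA ⊢
      linarith
    -- Nothing is homeward here, so the bound at the end of the trip is also the outward bound; the
    -- last moment at or beyond `y` realizes it.
    · obtain ⟨i, hi, hyi, hNi⟩ := h.exists_netBefore_ge hyd
      refine ⟨i, hi, hyi, le_trans ?_ hNi⟩
      have := final h0
      simp only [Convoy.outward, Convoy.arrive]
      linarith
  · have := final h0
    simp only [Convoy.outward, Convoy.homeward, Convoy.arrive]
    linarith
  · obtain rfl : y = 0 := h0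
    refine ⟨?_, hN⟩
    rcases hf with hf | hf
    · refine ⟨n, hn, le_trans ?_ hA⟩
      simp only [Convoy.outward, Convoy.arrive]
      linarith
    · refine ⟨N, le_rfl, le_trans ?_ hN⟩
      simp only [Convoy.outward, Convoy.arrive]
      linarith

/-- The three alternatives in `ho` select the moment that witnesses the outward bound: the old one,
the first arrival at or beyond the position, or the last moment there. -/
theorem Trip.dominates_of_pos_eq (h : Trip D st N) {c c' : Convoy} (hx : 0 < c.pos)
    (hxd : c.pos ≤ D.oasis) (hdom : Dominates D st N c) (hp : c'.pos = c.pos)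
    (ht : c'.outward - c'.homeward + c'.due - c'.stock =
      c.outward - c.homeward + c.due - c.stock)
    (ho : c'.outward - c'.stock ≤ c.outward - c.stock ∨ c'.outward - c'.stock ≤ 0 ∨
      c'.outward - c'.stock ≤ c.outward - c.homeward + c.due - c.stock) :
    Dominates D st N c' where
  outward _ := by
    rw [hp]
    rcases ho with ho | ho | ho
    · obtain ⟨n, hn, hpn, hA⟩ := hdom.outward hx
      exact ⟨n, hn, hpn, ho.trans hA⟩
    · obtain ⟨n, hn, hpn, hA⟩ := h.exists_netBefore_nonneg hxd
      exact ⟨n, hn, hpn, ho.trans hA⟩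
    · obtain ⟨n, hn, hpn, hA⟩ := h.exists_netBefore_ge hxd
      exact ⟨n, hn, hpn, (ho.trans (hdom.total hx)).trans hA⟩
  total _ := by
    rw [hp, ht]
    exact hdom.total hx
  border h0 := absurd (hp ▸ h0) hx.ne'

/-- At the border nothing is due or in stock and `Ready` fails, so no instruction applies. -/
theorem Convoy.Step.pos_pos {c c' : Convoy} (hs : Convoy.Step D c c') (hc : c.Sound D) :
    0 < c.pos := by
  rcases hc.pos_nonneg.eq_or_lt with h0 | h0
  · have hb := hc.border h0.symm
    have hr : ¬ c.Ready := fun hr => hr.2.2.ne h0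
    cases hs <;> simp_all
  · exact h0

theorem Trip.dominates_step (h : Trip D st N) (hdem : ∀ x, (D.demand x : ℝ) ≤ (st N).depot x)
    {c c' : Convoy} (hc : c.Sound D) (hs : Convoy.Step D c c') (hdom : Dominates D st N c) :
    Dominates D st N c' := by
  have hx := hs.pos_pos hc
  cases hs with
  | rideProper y hr hy hi hf hb =>
    refine h.dominates_arrive hdem hc hr hdom hy (m := c.bwd) (Or.inr ?_) (Or.inl rfl) ?_
    · simp only [Convoy.emptiness, Convoy.homeward] at *
      linarith
    · simp only [Convoy.outward, Convoy.homeward]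
      ring
  | rideImproper y hr hy hi hf =>
    refine h.dominates_arrive hdem hc hr hdom hy (m := 0) (Or.inl rfl)
      (Or.inr (by simp [hi.1, hi.2])) ?_
    simp only [Convoy.outward, Convoy.homeward]
    push_cast
    ring
  | createForward hn hf =>
    refine h.dominates_of_pos_eq hx hc.pos_le hdom rfl ?_ (Or.inl ?_) <;>
      simp only [Convoy.outward, Convoy.homeward] <;> push_cast <;> linarith
  | cancelBackward m hn hm he =>
    refine h.dominates_of_pos_eq hx hc.pos_le hdom rfl ?_ (Or.inl le_rfl)
    simp only [Convoy.outward, Convoy.homeward, hm]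
    push_cast
    ring
  | giveBackward hd hi he =>
    refine h.dominates_of_pos_eq hx hc.pos_le hdom rfl ?_ (Or.inl le_rfl)
    simp only [Convoy.outward, Convoy.homeward]
    ring
  | giveForward hd hi hf =>
    have := min_le_left c.due c.fwdFuel
    refine h.dominates_of_pos_eq hx hc.pos_le hdom rfl ?_ (Or.inr (Or.inr ?_)) <;>
      simp only [Convoy.outward, Convoy.homeward, hi.1, hi.2] <;> push_cast <;> linarith
  | absorbForward hd hs hf =>
    refine h.dominates_of_pos_eq hx hc.pos_le hdom rfl ?_ (Or.inl ?_) <;>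
      simp only [Convoy.outward, Convoy.homeward] <;> linarith
  | cancelForward k hd hs hk hf =>
    refine h.dominates_of_pos_eq hx hc.pos_le hdom rfl ?_ (Or.inl ?_) <;>
      simp only [Convoy.outward, Convoy.homeward, hk] <;> push_cast <;> linarith
  | absorbBackward hd hs hk hf he =>
    have := min_le_left c.stock (c.emptiness D)
    refine h.dominates_of_pos_eq hx hc.pos_le hdom rfl ?_ (Or.inr (Or.inl ?_)) <;>
      simp only [Convoy.outward, Convoy.homeward, hk] <;> push_cast <;> linarith
  | createBackward hd hs hk hf he =>
    refine h.dominates_of_pos_eq hx hc.pos_le hdom rfl ?_ (Or.inl le_rfl)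
    simp only [Convoy.outward, Convoy.homeward]
    push_cast
    ring

theorem Trip.used_mono (h : Trip D st N) (ha : D.returnAllowed = false) {n : ℕ} (hn : n ≤ N) :
    (st n).used ≤ (st N).used := by
  have key : ∀ k, n + k ≤ N → (st n).used ≤ (st (n + k)).used := by
    intro k
    induction k with
    | zero => intro; rfl
    | succ k ih =>
      intro hk
      refine (ih (by omega)).trans ?_
      have := h.step (n + k) hk
      rw [← add_assoc]
      generalize st (n + k + 1) = t at *
      cases this with
      | returnAtBorder u ha' => simp [ha] at ha'
      | takeAtBorder u hp h0 h1 => simpa using h0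
      | _ => exact le_rfl
  have := key (N - n) (by omega)
  rwa [Nat.add_sub_cancel' hn] at this

/-- Fuel lying at the border is nonnegative, so `used` bounds the net flow out of it. With credit
the final time counts; without credit `used` never decreases, so the intermediate outward bound
survives. -/
theorem Trip.borderFuel_le (h : Trip D st N) {c : Convoy} (h0 : c.pos = 0)
    (hdom : Dominates D st N c) : c.borderFuel D ≤ (st N).used := by
  obtain ⟨⟨n, hn, hA⟩, hN⟩ := hdom.border h0
  unfold Convoy.borderFuel
  split_ifs with ha
  · have h1 := h.used_eq (le_refl N)
    have h2 := (h.content_nonneg (le_refl N) 0).2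
    simp only [Convoy.outward, Convoy.homeward] at hN
    linarith
  · have h1 := h.used_eq hn
    have h2 := (h.content_nonneg hn 0).2
    have h3 := h.used_mono (by simpa using ha) hn
    simp only [Convoy.outward] at hA
    linarith

theorem IsNormalAlgorithm.exists_trip {S : List JeepState} {e : JeepState}
    (h : IsNormalAlgorithm D S e) : ∃ st N, Trip D st N ∧ st N = e := by
  obtain ⟨h1, h2, h3, ⟨s, hs, hs'⟩, h5⟩ := h
  have hne : S ≠ [] := by rintro rfl; simp at h1
  have hlen : 0 < S.length := List.length_pos_iff.2 hne
  have hget : ∀ i (hi : i < S.length), S.getD i e = S[i] := fun i hi => by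
    simp [List.getD_eq_getElem?_getD, hi]
  have hlast : S.getD (S.length - 1) e = e := by
    rw [hget _ (by omega)]
    rw [List.getLast?_eq_some_getLast hne, Option.some_inj, List.getLast_eq_getElem] at h3
    exact h3
  refine ⟨fun i => S.getD i e, S.length - 1, ⟨?_, fun i hi => ?_, ?_, ?_⟩, hlast⟩
  · rw [List.head?_eq_getElem?] at h1
    simp [List.getD_eq_getElem?_getD, h1]
  · rw [List.isChain_iff_getElem] at h2
    rw [hget i (by omega), hget (i + 1) (by omega)]
    exact h2 i (by omega)
  · obtain ⟨i, hi, rfl⟩ := List.getElem_of_mem hs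
    exact ⟨i, by omega, by rw [hget i hi]; exact hs'⟩
  · rw [hlast]
    exact h5

theorem IsConvoyAlgorithm.reflTransGen {T : List Convoy} {c : Convoy}
    (h : IsConvoyAlgorithm D T c) :
    Relation.ReflTransGen (Convoy.Step D) (Convoy.start D) c := by
  obtain ⟨h1, h2, h3, -⟩ := h
  obtain ⟨T, rfl⟩ : ∃ T', T = Convoy.start D :: T' := by
    cases T with
    | nil => simp at h1
    | cons a T => exact ⟨T, by simpa using h1⟩
  rw [List.getLast?_eq_some_getLast (by simp), Option.some_inj] at h3
  exact List.relationReflTransGen_of_exists_isChain_cons T h2 h3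

theorem IsConvoyAlgorithm.borderFuel_le {T : List Convoy} {c : Convoy}
    (h : IsConvoyAlgorithm D T c) {S : List JeepState} {e : JeepState}
    (hS : IsNormalAlgorithm D S e) (hd : ∀ x, (D.demand x : ℝ) ≤ e.depot x) :
    c.borderFuel D ≤ e.used := by
  obtain ⟨st, N, ht, rfl⟩ := hS.exists_trip
  have key : c.Sound D ∧ Dominates D st N c := by
    have hr := h.reflTransGen
    clear h
    induction hr with
    | refl => exact ⟨Convoy.sound_start D, ht.dominates_start hd⟩
    | tail _ hs ih => exact ⟨hs.sound ih.1, ht.dominates_step hd ih.1 hs ih.2⟩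
  exact ht.borderFuel_le h.ends key.2

end FineJeep

/-! ### Runs of one jeep with passage counts -/

namespace FineJeep

/-- `1` if a ride from `p` to `q` passes `z` in forward direction. -/
noncomputable def pass (p q z : ℝ) : ℕ := if p < z ∧ z < q then 1 else 0

theorem pass_eq_zero {p q : ℝ} (h : q ≤ p) : pass p q = 0 :=
  funext fun _ => if_neg fun h' => (h'.1.trans (h'.2.trans_le h)).false

@[simp] theorem pass_self (p : ℝ) : pass p p = 0 := pass_eq_zero le_rfl

theorem pass_of_le_left {p q z : ℝ} (h : z ≤ p) : pass p q z = 0 :=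
  if_neg fun h' => (h'.1.trans_le h).false

/-- The jeep can get from one state to another, with given numbers of forward and backward
passages; if `v` holds, then it visits the oasis. -/
inductive Run (D : Desert) : Prop → JeepState → JeepState → (ℝ → ℕ) → (ℝ → ℕ) → Prop
  | refl (s : JeepState) : Run D False s s 0 0
  | visit {v : Prop} {s t : JeepState} {F B : ℝ → ℕ} (h : s.pos = D.oasis) (hr : Run D v s t F B) :
      Run D True s t F B
  | step {v : Prop} {s t e : JeepState} {F B : ℝ → ℕ} (h : JeepStep D s t) (hr : Run D v t e F B) :
      Run D v s e (pass s.pos t.pos + F) (pass t.pos s.pos + B)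

namespace Run

variable {D : Desert}

theorem trans {v w : Prop} {s t e : JeepState} {F B F' B' : ℝ → ℕ} (h : Run D v s t F B)
    (h' : Run D w t e F' B') : Run D (v ∨ w) s e (F + F') (B + B') := by
  induction h with
  | refl s => simpa using h'
  | visit h _ ih => simpa using (ih h').visit h
  | step h _ ih => simpa [add_assoc] using (ih h').step h

theorem exists_list {v : Prop} {s e : JeepState} {F B : ℝ → ℕ} (h : Run D v s e F B) :
    ∃ S : List JeepState, (s :: S).IsChain (JeepStep D) ∧ (s :: S).getLast? = some e ∧
      (v → ∃ t ∈ s :: S, t.pos = D.oasis) ∧ (∀ z, forwardPasses (s :: S) z = F z) ∧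
      ∀ z, backwardPasses (s :: S) z = B z := by
  induction h with
  | refl s => exact ⟨[], by simp, by simp, by simp, by simp [forwardPasses], by simp [backwardPasses]⟩
  | @visit _ s _ _ _ h _ ih =>
    obtain ⟨S, h1, h2, -, h4, h5⟩ := ih
    exact ⟨S, h1, h2, fun _ => ⟨s, by simp, h⟩, h4, h5⟩
  | @step _ s t _ _ _ h _ ih =>
    obtain ⟨S, h1, h2, h3, h4, h5⟩ := ih
    refine ⟨t :: S, by simp [h, h1], by simpa using h2, fun hv => ?_, fun z => ?_, fun z => ?_⟩
    · obtain ⟨u, hu, hp⟩ := h3 hv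
      exact ⟨u, List.mem_cons_of_mem _ hu, hp⟩
    · have := h4 z
      simp only [forwardPasses, List.tail_cons, List.zip_cons_cons, List.countP_cons,
        Pi.add_apply, pass] at *
      rw [← this, add_comm]
      simp
    · have := h5 z
      simp only [backwardPasses, List.tail_cons, List.zip_cons_cons, List.countP_cons,
        Pi.add_apply, pass] at *
      rw [← this, add_comm]
      simp

theorem single {s t : JeepState} (h : JeepStep D s t) :
    Run D False s t (pass s.pos t.pos) (pass t.pos s.pos) := by
  simpa using (refl t).step h

end Run

variable {D : Desert}

/-- The jeep loads `A` at `p`, rides to `q`, and unloads there all but an amount `r`. -/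
theorem exists_run_transfer {p q A r : ℝ} (d : ℝ → ℝ) (w : ℝ) (hq : 0 ≤ q) (hqd : q ≤ D.oasis)
    (hpq : p ≠ q) (hA : A ≤ 1) (hAd : A ≤ d p) (hr : 0 ≤ r) (hrA : |q - p| + r ≤ A) :
    ∃ d', Run D False ⟨p, 0, d, w⟩ ⟨q, r, d', w⟩ (pass p q) (pass q p) ∧ d' p = d p - A ∧
      d' q = d q + (A - |q - p| - r) ∧ ∀ z, z ≠ p → z ≠ q → d' z = d z := by
  have habs := abs_nonneg (q - p)
  have h1 := JeepStep.load (D := D) ⟨p, 0, d, w⟩ A (by linarith) hAd (by simpa using hA)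
  have h2 := JeepStep.ride (D := D) ⟨p, 0 + A, Function.update d p (d p - A), w⟩ q hq hqd
    (by simp only; linarith)
  have h3 := JeepStep.unload (D := D) ⟨q, 0 + A - |q - p|, Function.update d p (d p - A), w⟩
    (A - |q - p| - r) (by linarith) (by simp only; linarith)
  have e : 0 + A - |q - p| - (A - |q - p| - r) = r := by ring
  simp only [e] at h3
  refine ⟨_, by simpa using ((Run.single h1).trans (Run.single h2)).trans (Run.single h3), ?_, ?_,
    fun z hz hz' => ?_⟩
  · simp [hpq]
  · simp [hpq.symm]
  · simp [hz, hz']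

/-- The jeep carries an amount `A` from `p` towards `q`, riding `k + 1` times from `p` to `q` and
`k` times from `q` to `p`. -/
theorem exists_run_move {p q : ℝ} (hp : 0 ≤ p) (hpd : p ≤ D.oasis) (hq : 0 ≤ q)
    (hqd : q ≤ D.oasis) (hpq : p ≠ q) (k : ℕ) (hk : k = 0 ∨ |q - p| ≤ 1 / 2) :
    ∀ {A : ℝ} (d : ℝ → ℝ) (w : ℝ), k + |q - p| ≤ A → A ≤ k + 1 → A ≤ d p →
    ∃ d', Run D False ⟨p, 0, d, w⟩ ⟨q, 0, d', w⟩
      (fun z => (k + 1) * pass p q z + k * pass q p z)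
      (fun z => (k + 1) * pass q p z + k * pass p q z) ∧
      d' p = d p - A ∧ d' q = d q + (A - (2 * k + 1) * |q - p|) ∧
      ∀ z, z ≠ p → z ≠ q → d' z = d z := by
  induction k with
  | zero =>
    intro A d w h1 h2 h3
    obtain ⟨d', r, a, b, c⟩ := exists_run_transfer (r := 0) d w hq hqd hpq (by simpa using h2) h3
      le_rfl (by simpa using h1)
    refine ⟨d', by simpa using r, a, ?_, c⟩
    rw [b]
    push_cast
    ring
  | succ k ih =>
    intro A d w h1 h2 h3
    have hk := hk.resolve_left (Nat.succ_ne_zero k)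
    have habs := abs_nonneg (q - p)
    push_cast at h1 h2
    have hk0 : (0 : ℝ) ≤ k := Nat.cast_nonneg k
    -- A full tank is taken, and just enough for riding back is kept; this is where the distance
    -- must not exceed 1/2.
    obtain ⟨d1, r1, a1, b1, c1⟩ := exists_run_transfer (r := |q - p|) d w hq hqd hpq le_rfl
      (by linarith) habs (by linarith)
    have r2 := Run.single (JeepStep.ride (D := D) ⟨q, |q - p|, d1, w⟩ p hp hpd
      (by simp only; rw [abs_sub_comm]))
    simp only [abs_sub_comm p q, sub_self] at r2
    obtain ⟨d3, r3, a3, b3, c3⟩ := ih (Or.inr hk) (A := A - 1) d1 w (by linarith) (by linarith)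
      (by linarith)
    refine ⟨d3, ?_, by rw [a3, a1]; ring, by rw [b3, b1]; push_cast; ring, fun z hz hz' => ?_⟩
    · convert (r1.trans r2).trans r3 using 1
      · simp
      · funext z
        simp only [Pi.add_apply]
        ring
      · funext z
        simp only [Pi.add_apply]
        ring
    · rw [c3 z hz hz', c1 z hz hz']

/-! ### Plans and their extension over a new stretch -/

/-- If an amount `need` is at `x`, in addition to the given depots beyond `x`, then the jeep can
ride from `x` and come back to `x`, so that an amount `left` is at `x`, in addition to the
depots `E` beyond `x`. -/
def OutPlan (D : Desert) (v : Prop) (x need left : ℝ) (E : ℝ → ℝ) (F B : ℝ → ℕ) : Prop :=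
  ∀ (d : ℝ → ℝ) (w : ℝ), (∀ z, x < z → d z = D.supply z) → need ≤ d x →
    ∃ d', Run D v ⟨x, 0, d, w⟩ ⟨x, 0, d', w⟩ F B ∧ (∀ z, x < z → d' z = E z) ∧
      d' x = d x - need + left ∧ ∀ z, z < x → d' z = d z

/-- If an amount `r` is at `x`, in addition to the depots `E` beyond `x`, then the jeep can ride
from `x` to the oasis, so that the depots beyond `x` get filled. -/
def HomePlan (D : Desert) (x r : ℝ) (E : ℝ → ℝ) (F B : ℝ → ℕ) : Prop :=
  ∀ (d : ℝ → ℝ) (w : ℝ), (∀ z, x < z → d z = E z) → r ≤ d x →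
    ∃ d', Run D False ⟨x, 0, d, w⟩ ⟨D.oasis, 0, d', w⟩ F B ∧ (∀ z, x < z → d' z = D.demand z) ∧
      d' x = d x - r ∧ ∀ z, z < x → d' z = d z

/-- Surplus fuel at `x` is left lying there. -/
theorem OutPlan.add {v : Prop} {x n l : ℝ} {E : ℝ → ℝ} {F B : ℝ → ℕ}
    (h : OutPlan D v x n l E F B) {t : ℝ} (ht : 0 ≤ t) : OutPlan D v x (n + t) (l + t) E F B := by
  intro d w hd hn
  obtain ⟨d', h1, h2, h3, h4⟩ := h d w hd (by linarith)
  exact ⟨d', h1, h2, by rw [h3]; ring, h4⟩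

theorem outPlan_refl (D : Desert) (x n : ℝ) :
    OutPlan D False x n n (fun z => D.supply z) 0 0 :=
  fun d w hd _ => ⟨d, .refl _, hd, by ring, fun _ _ => rfl⟩

/-- Carry `A` to `x`, run the old plan, carry `C` back. The bounds on `A` and `C` let all trips but
the last take a full tank, while the last load still covers its ride; `E' x` is what remains at `x`.
-/
theorem OutPlan.extend {v : Prop} {x y n l A C : ℝ} {E E' : ℝ → ℝ} {F B : ℝ → ℕ}
    (h : OutPlan D v x n l E F B) (hy : 0 ≤ y) (hyx : y < x) (hxd : x ≤ D.oasis)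
    (hs : ∀ z, y < z → z < x → D.supply z = 0) {k m : ℕ}
    (hk : k = 0 ∨ x - y ≤ 1 / 2) (hm : m = 0 ∨ x - y ≤ 1 / 2)
    (hA : k + (x - y) ≤ A) (hA' : A ≤ k + 1) (hC : m + (x - y) ≤ C) (hC' : C ≤ m + 1)
    (hn : n ≤ D.supply x + (A - (2 * k + 1) * (x - y)))
    (hE : ∀ z, x < z → E' z = E z) (hE0 : ∀ z, y < z → z < x → E' z = 0)
    (hEx : E' x = D.supply x + (A - (2 * k + 1) * (x - y)) - n + l - C) (hEx0 : 0 ≤ E' x) :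
    OutPlan D v y A (C - (2 * m + 1) * (x - y)) E'
      (fun z => (k + 1 + m) * pass y x z + F z) (fun z => (k + m + 1) * pass y x z + B z) := by
  intro d w hd hAd
  have e1 : |x - y| = x - y := abs_of_pos (by linarith)
  have e2 : |y - x| = x - y := by rw [abs_sub_comm, e1]
  have hx0 := hy.trans hyx.le
  have hyd := hyx.le.trans hxd
  obtain ⟨d1, r1, a1, b1, c1⟩ := exists_run_move hy hyd hx0 hxd hyx.ne k (by rwa [e1]) d w
    (by rwa [e1]) hA' hAd
  rw [e1, hd x hyx] at b1
  obtain ⟨d2, r2, a2, b2, c2⟩ := h d1 w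
    (fun z hz => by rw [c1 z (by linarith) hz.ne', hd z (by linarith)]) (by rw [b1]; exact hn)
  obtain ⟨d3, r3, a3, b3, c3⟩ := exists_run_move hx0 hxd hy hyd hyx.ne' m (by rwa [e2]) (A := C)
    d2 w (by rwa [e2]) hC' (by rw [b2, b1]; linarith)
  rw [e2] at b3
  refine ⟨d3, ?_, fun z hz => ?_, ?_, fun z hz => ?_⟩
  · convert (r1.trans r2).trans r3 using 1
    · simp
    · funext z
      simp only [Pi.add_apply]
      rw [pass_eq_zero hyx.le]
      simp only [Pi.zero_apply]
      ring
    · funext z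
      simp only [Pi.add_apply]
      rw [pass_eq_zero hyx.le]
      simp only [Pi.zero_apply]
      ring
  · rcases lt_trichotomy z x with h' | rfl | h'
    · rw [c3 z h'.ne hz.ne', c2 z h', c1 z hz.ne' h'.ne, hd z hz, hs z hz h', hE0 z hz h']
      simp
    · rw [a3, b2, b1, hEx]
    · rw [c3 z h'.ne' hz.ne', a2 z h', hE z h']
  · rw [b3, c2 y hyx, a1]
  · rw [c3 z (by linarith) hz.ne, c2 z (by linarith), c1 z hz.ne (by linarith)]

/-- The final ride takes exactly its consumption from `y`, arrives at `x` empty, and goes on with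
the reserve `r` that was left there. -/
theorem HomePlan.extend {x y r : ℝ} {E E' : ℝ → ℝ} {F B : ℝ → ℕ} (h : HomePlan D x r E F B)
    (hy : 0 ≤ y) (hyx : y < x) (hxd : x ≤ D.oasis) (hh : x - y ≤ 1)
    (hs : ∀ z, y < z → z < x → D.demand z = 0)
    (hE : ∀ z, x < z → E' z = E z) (hE0 : ∀ z, y < z → z < x → E' z = 0)
    (hEx : E' x = D.demand x + r) :
    HomePlan D y (x - y) E' (fun z => pass y x z + F z) B := by
  intro d w hd hr
  have e1 : |x - y| = x - y := abs_of_pos (by linarith)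
  obtain ⟨d1, r1, a1, b1, c1⟩ := exists_run_transfer (D := D) (r := 0) d w (hy.trans hyx.le) hxd
    hyx.ne hh hr le_rfl (by rw [e1, add_zero])
  rw [e1, hd x hyx, hEx] at b1
  obtain ⟨d2, r2, a2, b2, c2⟩ := h d1 w
    (fun z hz => by rw [c1 z (by linarith) hz.ne', hd z (by linarith), hE z hz])
    (by rw [b1]; have : (0 : ℝ) ≤ D.demand x := NNReal.coe_nonneg _
        linarith)
  refine ⟨d2, ?_, fun z hz => ?_, ?_, fun z hz => ?_⟩
  · convert r1.trans r2 using 1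
    · simp
    · rfl
    · rw [pass_eq_zero hyx.le, zero_add]
  · rcases lt_trichotomy z x with h' | rfl | h'
    · rw [c2 z h', c1 z hz.ne' h'.ne, hd z hz, hE0 z hz h', hs z hz h']
      simp
    · rw [b2, b1]
      ring
    · exact a2 z h'
  · rw [c2 y hyx, a1]
  · rw [c2 z (by linarith), c1 z hz.ne (by linarith)]

/-- A one-way trip over a stretch where the jeep does not return. -/
theorem HomePlan.extend_whole {x y n l r A : ℝ} {E : ℝ → ℝ} {F B F' B' : ℝ → ℕ}
    (h : OutPlan D False x n l E F B) (h' : HomePlan D x r E F' B')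
    (hy : 0 ≤ y) (hyx : y < x) (hxd : x ≤ D.oasis)
    (hs : ∀ z, y < z → z < x → D.supply z = 0 ∧ D.demand z = 0) {k : ℕ}
    (hk : k = 0 ∨ x - y ≤ 1 / 2) (hA : k + (x - y) ≤ A) (hA' : A ≤ k + 1)
    (hn : n = D.supply x + (A - (2 * k + 1) * (x - y))) (hl : l = D.demand x + r) :
    HomePlan D y A (fun z => D.supply z)
      (fun z => (k + 1) * pass y x z + (F z + F' z))
      (fun z => k * pass y x z + (B z + B' z)) := by
  intro d w hd hAd
  have e1 : |x - y| = x - y := abs_of_pos (by linarith)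
  have hx0 := hy.trans hyx.le
  have hyd := hyx.le.trans hxd
  obtain ⟨d1, r1, a1, b1, c1⟩ := exists_run_move hy hyd hx0 hxd hyx.ne k (by rwa [e1]) d w
    (by rwa [e1]) hA' hAd
  rw [e1, hd x hyx, ← hn] at b1
  obtain ⟨d2, r2, a2, b2, c2⟩ := h d1 w
    (fun z hz => by rw [c1 z (by linarith) hz.ne', hd z (by linarith)]) b1.ge
  rw [b1, sub_self, zero_add, hl] at b2
  obtain ⟨d3, r3, a3, b3, c3⟩ := h' d2 w a2
    (by rw [b2]; have : (0 : ℝ) ≤ D.demand x := NNReal.coe_nonneg _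
        linarith)
  refine ⟨d3, ?_, fun z hz => ?_, ?_, fun z hz => ?_⟩
  · convert (r1.trans r2).trans r3 using 1
    · simp
    · funext z
      simp [pass_eq_zero hyx.le, add_assoc]
    · funext z
      simp [pass_eq_zero hyx.le, add_assoc]
  · rcases lt_trichotomy z x with h' | rfl | h'
    · rw [c3 z h', c2 z h', c1 z hz.ne' h'.ne, hd z hz, (hs z hz h').2]
      simp [(hs z hz h').1]
    · rw [b3, b2]
      ring
    · exact a3 z h'
  · rw [c3 y hyx, c2 y hyx, a1]
  · rw [c3 z (by linarith), c2 z (by linarith), c1 z hz.ne (by linarith)]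

end FineJeep

/-! ### Executing the convoy by one jeep -/

namespace FineJeep

variable {D : Desert}

/-- The fuel at the position of the convoy that the jeep needs to start with. -/
noncomputable def Convoy.need (D : Desert) (c : Convoy) : ℝ :=
  c.outward + D.supply c.pos - c.stock

/-- The fuel at the position of the convoy that the jeep leaves there. -/
noncomputable def Convoy.left (D : Desert) (c : Convoy) : ℝ :=
  c.homeward + D.demand c.pos - c.due

/-- The part of the convoy algorithm until configuration `c` can be executed by one jeep, with given
numbers of forward and backward passages. -/
def Plan (D : Desert) (c : Convoy) (F B : ℝ → ℕ) : Prop :=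
  (∀ z ≤ c.pos, F z = 0 ∧ B z = 0) ∧
  ((D.roundTrip = true ∧
      OutPlan D True c.pos (c.need D) (c.left D) (fun z => D.demand z) F B) ∨
    (D.roundTrip = false ∧ ∃ (r : ℝ) (E : ℝ → ℝ) (F₁ B₁ F₂ B₂ : ℝ → ℕ), 0 ≤ r ∧
      OutPlan D False c.pos (c.need D) (c.left D + r) E F₁ B₁ ∧ HomePlan D c.pos r E F₂ B₂ ∧
      F = F₁ + F₂ ∧ B = B₁ + B₂))

theorem plan_start (D : Desert) : Plan D (Convoy.start D) 0 0 := by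
  have hn : (Convoy.start D).need D = 0 := by
    simp [Convoy.need, Convoy.outward, Convoy.start]
  have hl : (Convoy.start D).left D = 0 := by
    simp [Convoy.left, Convoy.homeward, Convoy.start]
  have hsd : ∀ z, D.oasis < z → D.supply z = D.demand z := fun z hz => by
    rw [D.supply_eq_zero (Or.inr hz), D.demand_eq_zero (Or.inr hz)]
  refine ⟨fun _ _ => ⟨rfl, rfl⟩, ?_⟩
  rw [hn, hl]
  cases hr : D.roundTrip
  · refine Or.inr ⟨rfl, 0, fun z => D.supply z, 0, 0, 0, 0, le_rfl, ?_, ?_, by simp, by simp⟩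
    · rw [add_zero]
      exact outPlan_refl D _ 0
    · intro d w hd _
      exact ⟨d, .refl _, fun z hz => by simp [hd z hz, hsd z hz], by ring, fun _ _ => rfl⟩
  · refine Or.inl ⟨rfl, fun d w hd _ => ⟨d, .visit rfl (.refl _), fun z hz => ?_, by ring,
      fun _ _ => rfl⟩⟩
    rw [hd z hz, hsd z hz]

/-- Instructions at a fixed position change need and left by the same amount `t`, which the plan
never moves. It is nonzero only when the forward subconvoy fills a depot or the backward one absorbs
stock. -/
theorem Plan.add {c c' : Convoy} {F B : ℝ → ℕ} (h : Plan D c F B) (hp : c'.pos = c.pos) {t : ℝ}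
    (ht : 0 ≤ t) (hn : c'.outward - c'.stock = c.outward - c.stock + t)
    (hl : c'.homeward - c'.due = c.homeward - c.due + t) : Plan D c' F B := by
  have hn' : c'.need D = c.need D + t := by
    simp only [Convoy.need, hp]
    linarith
  have hl' : c'.left D = c.left D + t := by
    simp only [Convoy.left, hp]
    linarith
  unfold Plan
  rw [hp, hn', hl']
  refine ⟨h.1, h.2.imp (fun h => ⟨h.1, h.2.add ht⟩) fun h => ⟨h.1, ?_⟩⟩
  obtain ⟨r, E, F₁, B₁, F₂, B₂, h1, h2, h3, h4⟩ := h.2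
  exact ⟨r, E, F₁, B₁, F₂, B₂, h1, by simpa [add_right_comm] using h2.add ht, h3, h4⟩

theorem Plan.arrive {c : Convoy} {F B : ℝ → ℕ} (h : Plan D c F B) (hc : c.Sound D) (hr : c.Ready)
    {y f g : ℝ} (hy : Convoy.FreeRoad D c y) (hf0 : 0 ≤ f) (hg0 : 0 ≤ g)
    (hride : (¬ c.Improper ∧ f = c.fwdFuel - (2 * c.fwd + 1) * (c.pos - y) ∧
        g = c.bwdFuel - (2 * c.bwd + D.ringle) * (c.pos - y) ∧ 2 * c.bwd + D.ringle - g ≤ 1) ∨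
      (c.Improper ∧ f = c.fwdFuel - (2 * c.fwd + 1 + D.ringle) * (c.pos - y) ∧ g = c.bwdFuel)) :
    Plan D (c.arrive D y f g) (fun z => (c.fwd + 1 + c.bwd) * pass y c.pos z + F z)
      (fun z => (c.fwd + c.bwd + D.ringle) * pass y c.pos z + B z) := by
  obtain ⟨hd, hs, hx⟩ := hr
  obtain ⟨hy0, hyx, hfree⟩ := hy
  obtain ⟨h0, hplan⟩ := h
  have hh : 0 < c.pos - y := by linarith
  have hf1 := hc.fwdFuel_le
  have hg1 := hc.bwdFuel_nonneg
  have he0 := hc.emptiness_nonneg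
  have hxd := hc.pos_le
  have hb0 : (0 : ℝ) ≤ D.demand c.pos := NNReal.coe_nonneg _
  have hρ0 : (0 : ℝ) ≤ D.ringle := Nat.cast_nonneg _
  have hk0 : (0 : ℝ) ≤ c.fwd := Nat.cast_nonneg _
  have p1 := mul_nonneg hk0 hh.le
  have p2 := mul_nonneg hρ0 hh.le
  -- With a double jeep present, the consumption is at least 3 per unit from at most one tankload.
  have hk : c.fwd = 0 ∨ c.pos - y ≤ 1 / 2 := by
    rcases Nat.eq_zero_or_pos c.fwd with h | h
    · exact Or.inl h
    · right
      have h : (1 : ℝ) ≤ c.fwd := by exact_mod_cast h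
      have := mul_le_mul_of_nonneg_right h hh.le
      rcases hride with ⟨-, h1, -⟩ | ⟨-, h1, -⟩ <;> linarith
  have hneed : c.need D = c.fwd + 1 - c.fwdFuel + D.supply c.pos := by
    simp only [Convoy.need, Convoy.outward, hs]
    ring
  have hleft : c.left D = c.bwdFuel - c.bwd + D.demand c.pos := by
    simp only [Convoy.left, Convoy.homeward, hd]
    ring
  have hneed' : (c.arrive D y f g).need D = c.fwd + 1 - f := by
    simp only [Convoy.need, Convoy.outward, Convoy.arrive]
    ring
  have hleft' : (c.arrive D y f g).left D = g - c.bwd := by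
    simp only [Convoy.left, Convoy.homeward, Convoy.arrive]
    ring
  refine ⟨fun z hz => ?_, ?_⟩
  · have hz : z ≤ y := hz
    obtain ⟨h1, h2⟩ := h0 z (by linarith)
    simp [h1, h2, pass_of_le_left hz]
  rw [hneed', hleft', show (c.arrive D y f g).pos = y from rfl]
  rw [hneed, hleft] at hplan
  have hsup : ∀ z, y < z → z < c.pos → D.supply z = 0 := fun z h1 h2 => (hfree z h1 h2).1
  rcases hplan with ⟨hrt, hout⟩ | ⟨hrt, r, E, F₁, B₁, F₂, B₂, hr0, hout, hhome, rfl, rfl⟩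
  · have hρ : D.ringle = 1 := by simp [Desert.ringle, hrt]
    rw [hρ] at hride ⊢
    refine Or.inl ⟨hrt, ?_⟩
    have hdem : ∀ z, y < z → z < c.pos → ((D.demand z : ℝ≥0) : ℝ) = 0 := fun z h1 h2 => by
      simp [(hfree z h1 h2).2]
    push_cast at hride
    simp only [Convoy.emptiness, hρ] at he0
    push_cast at he0
    rcases hride with ⟨hi, hf, hg, he⟩ | ⟨hi, hf, hg⟩
    · have hm0 : (0 : ℝ) ≤ c.bwd := Nat.cast_nonneg _
      have p3 := mul_nonneg hm0 hh.le
      have hm : c.bwd = 0 ∨ c.pos - y ≤ 1 / 2 := by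
        rcases Nat.eq_zero_or_pos c.bwd with h | h
        · exact Or.inl h
        · right
          have h : (1 : ℝ) ≤ c.bwd := by exact_mod_cast h
          have := mul_le_mul_of_nonneg_right h hh.le
          linarith
      have hmg : (c.bwd : ℝ) ≤ g := by linarith
      have := hout.extend (A := c.fwd + 1 - f) (C := c.bwdFuel - c.bwd)
        (E' := fun z => D.demand z) hy0 hyx hxd hsup hk hm
        (by linarith) (by linarith) (by linarith) (by linarith) (by rw [hf]; linarith)
        (fun _ _ => rfl) hdem (by rw [hf]; ring) hb0
      convert this using 1
      rw [hg]
      ring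
    · have hm0 := hi.1
      -- The ride back burns all of `C`. This fuel was carried out with the rest, since the forward
      -- subconvoy feeds the empty ringle jeep.
      have := hout.extend (A := c.fwd + 1 - f) (C := c.pos - y) (m := 0)
        (E' := fun z => D.demand z) hy0 hyx hxd hsup hk (Or.inl rfl)
        (by linarith) (by linarith) (by simp) (by push_cast; linarith) (by rw [hf]; linarith)
        (fun _ _ => rfl) hdem (by rw [hf, hi.1, hi.2]; push_cast; ring) hb0
      convert this using 1
      · rw [hg, hi.1, hi.2]
        push_cast
        ring
      · rw [hi.1]
      · rw [hi.1]
  · have hρ : D.ringle = 0 := by simp [Desert.ringle, hrt]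
    rw [hρ] at hride ⊢
    refine Or.inr ⟨hrt, ?_⟩
    push_cast at hride
    simp only [Convoy.emptiness, hρ] at he0
    push_cast at he0
    rcases hride with ⟨hi, hf, hg, he⟩ | ⟨hi, hf, hg⟩
    -- The `m + 1` double jeeps stand for `m + 1` backward and `m` forward passages of the
    -- `OutPlan`, and the one forward passage of the final ride.
    · obtain ⟨m, hm⟩ : ∃ m, c.bwd = m + 1 := by
        refine Nat.exists_eq_succ_of_ne_zero fun h => hi ⟨h, ?_⟩
        rw [h] at he0
        push_cast at he0
        linarith
      have hm0 : (0 : ℝ) ≤ m := Nat.cast_nonneg _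
      have p3 := mul_nonneg hm0 hh.le
      rw [hm] at hg he he0 hout ⊢
      push_cast at hg he he0 hout ⊢
      have hm' : m = 0 ∨ c.pos - y ≤ 1 / 2 := by
        rcases Nat.eq_zero_or_pos m with h | h
        · exact Or.inl h
        · right
          have h : (1 : ℝ) ≤ m := by exact_mod_cast h
          have := mul_le_mul_of_nonneg_right h hh.le
          linarith
      -- The old reserve `r` stays at `c.pos`; the new reserve at `y` is only `c.pos - y`.
      set E' : ℝ → ℝ := fun z => if c.pos < z then E z else
        if z = c.pos then D.demand c.pos + r else 0 with hE'
      have hE1 : ∀ z, c.pos < z → E' z = E z := fun z hz => if_pos hz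
      have hE2 : ∀ z, y < z → z < c.pos → E' z = 0 := fun z _ hz => by
        simp [hE', not_lt.2 hz.le, hz.ne]
      have hE3 : E' c.pos = D.demand c.pos + r := by simp [hE']
      have ho := hout.extend (A := c.fwd + 1 - f) (C := c.bwdFuel - (m + 1))
        (E' := E') hy0 hyx hxd hsup hk hm'
        (by linarith) (by linarith) (by linarith) (by linarith) (by rw [hf]; linarith)
        hE1 hE2 (by rw [hf, hE3]; ring) (by rw [hE3]; linarith)
      have hho := hhome.extend hy0 hyx hxd (by linarith)
        (fun z h1 h2 => (hfree z h1 h2).2) hE1 hE2 hE3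
      rw [show c.bwdFuel - (m + 1) - (2 * m + 1) * (c.pos - y) = g - (m + 1) + (c.pos - y) by
        rw [hg]; ring] at ho
      refine ⟨_, E', _, _, _, _, hh.le, ho, hho, ?_, ?_⟩
      · funext z
        simp only [Pi.add_apply]
        ring
      · funext z
        simp only [Pi.add_apply]
        ring
    · have hm0 := hi.1
      have hg00 := hi.2
      -- Nothing comes back over this stretch, so the whole earlier plan becomes part of the final
      -- ride; the new `OutPlan` is empty, and the reserve is everything needed at `y`.
      have hho := HomePlan.extend_whole (A := c.fwd + 1 - f) hout hhome hy0 hyx hxd hfree hk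
        (by linarith) (by linarith) (by rw [hf]; ring) (by rw [hm0, hg00]; push_cast; ring)
      refine ⟨c.fwd + 1 - f, _, 0, 0, _, _, by linarith, ?_, hho, ?_, ?_⟩
      · rw [hg, hm0, hg00]
        simpa using outPlan_refl D y (c.fwd + 1 - f)
      · funext z
        simp only [Pi.add_apply, Pi.zero_apply, hm0]
        ring
      · funext z
        simp only [Pi.add_apply, Pi.zero_apply, hm0]
        ring

/-- A ride adds passages only strictly below `c.pos`, where the earlier counts vanish; counts on
stretches already ridden are therefore final. -/
theorem Plan.exists_step {c c' : Convoy} {F B : ℝ → ℕ} (h : Plan D c F B) (hc : c.Sound D)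
    (hs : Convoy.Step D c c') : ∃ F' B', Plan D c' F' B' ∧
      (∀ z, c.pos ≤ z → F' z = F z ∧ B' z = B z) ∧
      ∀ z, c'.pos < z → z < c.pos → F' z = c.fwd + 1 + c.bwd ∧ B' z = c.fwd + c.bwd + D.ringle := by
  have stay : ∀ c' : Convoy, c'.pos = c.pos → Plan D c' F B → ∃ F' B', Plan D c' F' B' ∧
      (∀ z, c.pos ≤ z → F' z = F z ∧ B' z = B z) ∧
      ∀ z, c'.pos < z → z < c.pos →
        F' z = c.fwd + 1 + c.bwd ∧ B' z = c.fwd + c.bwd + D.ringle :=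
    fun c' hp h' => ⟨F, B, h', fun _ _ => ⟨rfl, rfl⟩, fun z h1 h2 => by rw [hp] at h1; linarith⟩
  have ride : ∀ y f g, Plan D (c.arrive D y f g)
      (fun z => (c.fwd + 1 + c.bwd) * pass y c.pos z + F z)
      (fun z => (c.fwd + c.bwd + D.ringle) * pass y c.pos z + B z) →
      ∃ F' B', Plan D (c.arrive D y f g) F' B' ∧
      (∀ z, c.pos ≤ z → F' z = F z ∧ B' z = B z) ∧
      ∀ z, (c.arrive D y f g).pos < z → z < c.pos →
        F' z = c.fwd + 1 + c.bwd ∧ B' z = c.fwd + c.bwd + D.ringle := by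
    intro y f g h'
    refine ⟨_, _, h', fun z hz => ?_, fun z h1 h2 => ?_⟩
    · have : pass y c.pos z = 0 := if_neg fun h => (h.2.trans_le hz).false
      simp [this]
    · obtain ⟨h3, h4⟩ := h.1 z h2.le
      have h1 : y < z := h1
      simp [pass, h1, h2, h3, h4]
  have hc' := hs.sound hc
  cases hs with
  | rideProper y hr hy hi hf hb =>
    refine ride _ _ _ (h.arrive hc hr hy hc'.fwdFuel_nonneg hc'.bwdFuel_nonneg
      (Or.inl ⟨hi, rfl, rfl, ?_⟩))
    simp only [Convoy.emptiness] at hb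
    linarith
  | rideImproper y hr hy hi hf =>
    exact ride _ _ _ (h.arrive hc hr hy hc'.fwdFuel_nonneg hc'.bwdFuel_nonneg
      (Or.inr ⟨hi, rfl, rfl⟩))
  | createForward hn hf =>
    refine stay _ rfl (h.add rfl le_rfl ?_ ?_) <;>
      simp only [Convoy.outward, Convoy.homeward] <;> push_cast <;> linarith
  | cancelBackward m hn hm he =>
    refine stay _ rfl (h.add rfl le_rfl ?_ ?_) <;>
      simp only [Convoy.outward, Convoy.homeward, hm] <;> push_cast <;> linarith
  | giveBackward hd hi he =>
    refine stay _ rfl (h.add rfl le_rfl ?_ ?_) <;>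
      simp only [Convoy.outward, Convoy.homeward] <;> linarith
  | giveForward hd hi hf =>
    refine stay _ rfl (h.add rfl (le_min hc.due_nonneg hc.fwdFuel_nonneg) ?_ ?_) <;>
      simp only [Convoy.outward, Convoy.homeward] <;> ring
  | absorbForward hd hs hf =>
    refine stay _ rfl (h.add rfl le_rfl ?_ ?_) <;>
      simp only [Convoy.outward, Convoy.homeward] <;> linarith
  | cancelForward k hd hs hk hf =>
    refine stay _ rfl (h.add rfl le_rfl ?_ ?_) <;>
      simp only [Convoy.outward, Convoy.homeward, hk] <;> push_cast <;> linarith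
  | absorbBackward hd hs hk hf he =>
    refine stay _ rfl (h.add rfl (le_min hc.stock_nonneg hc.emptiness_nonneg) ?_ ?_) <;>
      simp only [Convoy.outward, Convoy.homeward] <;> ring
  | createBackward hd hs hk hf he =>
    refine stay _ rfl (h.add rfl le_rfl ?_ ?_) <;>
      simp only [Convoy.outward, Convoy.homeward] <;> push_cast <;> linarith

theorem Plan.exists_final (T : List Convoy) : ∀ {c e : Convoy} {F B : ℝ → ℕ}, Plan D c F B →
    c.Sound D → (c :: T).IsChain (Convoy.Step D) → (c :: T).getLast? = some e →
    e.Sound D ∧ ∃ F' B', Plan D e F' B' ∧ (∀ z, c.pos ≤ z → F' z = F z ∧ B' z = B z) ∧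
      ∀ p ∈ (c :: T).zip T, ∀ z, p.2.pos < z → z < p.1.pos →
        F' z = p.1.fwd + 1 + p.1.bwd ∧ B' z = p.1.fwd + p.1.bwd + D.ringle := by
  induction T with
  | nil =>
    intro c e F B h hc _ he
    obtain rfl : c = e := by simpa using he
    exact ⟨hc, F, B, h, fun _ _ => ⟨rfl, rfl⟩, by simp⟩
  | cons c' T ih =>
    intro c e F B h hc hT he
    rw [List.isChain_cons_cons] at hT
    have hle : c'.pos ≤ c.pos := by
      cases hT.1 with
      | rideProper y hr hy => exact hy.2.1.le
      | rideImproper y hr hy => exact hy.2.1.le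
      | _ => exact le_rfl
    obtain ⟨F₁, B₁, h1, h2, h3⟩ := h.exists_step hc hT.1
    obtain ⟨he', F', B', h4, h5, h6⟩ := ih h1 (hT.1.sound hc) hT.2 (by simpa using he)
    refine ⟨he', F', B', h4, fun z hz => ?_, fun p hp z hz hz' => ?_⟩
    · rw [(h5 z (hle.trans hz)).1, (h5 z (hle.trans hz)).2]
      exact h2 z hz
    · rw [List.zip_cons_cons, List.mem_cons] at hp
      rcases hp with rfl | hp
      · rw [(h5 z hz.le).1, (h5 z hz.le).2]
        exact h3 z hz hz'
      · exact h6 p hp z hz hz'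

/-! ### Trade at the border and assembly -/

theorem exists_run_fill (n : ℕ) : ∀ {A : ℝ} (d : ℝ → ℝ) (w : ℝ), 0 ≤ A → A ≤ n →
    ∃ d', Run D False ⟨0, 0, d, w⟩ ⟨0, 0, d', w + A⟩ 0 0 ∧ d' 0 = d 0 + A ∧
      ∀ z, z ≠ 0 → d' z = d z := by
  induction n with
  | zero =>
    intro A d w h0 hA
    obtain rfl : A = 0 := le_antisymm (by simpa using hA) h0
    exact ⟨d, by simpa using Run.refl _, by simp, fun _ _ => rfl⟩
  | succ n ih =>
    intro A d w h0 hA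
    push_cast at hA
    have t0 : 0 ≤ min A 1 := le_min h0 zero_le_one
    have t1 : A - min A 1 ≤ n := by
      rcases min_choice A 1 with h | h <;> rw [h]
      · simp
      · linarith
    have h1 := JeepStep.takeAtBorder (D := D) ⟨0, 0, d, w⟩ (min A 1) rfl t0 (by simp)
    have h2 := JeepStep.unload (D := D) ⟨0, 0 + min A 1, d, w + min A 1⟩ (min A 1) t0 (by simp)
    simp only [zero_add, sub_self] at h1 h2
    obtain ⟨d', h3, h4, h5⟩ := ih (Function.update d 0 (d 0 + min A 1)) (w + min A 1)
      (sub_nonneg.2 (min_le_left A 1)) t1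
    rw [show w + min A 1 + (A - min A 1) = w + A by ring] at h3
    refine ⟨d', by simpa using ((Run.single h1).trans (Run.single h2)).trans h3, ?_, fun z hz => ?_⟩
    · rw [h4]
      simp
    · rw [h5 z hz]
      simp [hz]

theorem exists_run_return (ha : D.returnAllowed = true) (n : ℕ) : ∀ {A : ℝ} (d : ℝ → ℝ) (w : ℝ),
    0 ≤ A → A ≤ n → A ≤ d 0 →
    ∃ d', Run D False ⟨0, 0, d, w⟩ ⟨0, 0, d', w - A⟩ 0 0 ∧ d' 0 = d 0 - A ∧
      ∀ z, z ≠ 0 → d' z = d z := by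
  induction n with
  | zero =>
    intro A d w h0 hA _
    obtain rfl : A = 0 := le_antisymm (by simpa using hA) h0
    exact ⟨d, by simpa using Run.refl _, by simp, fun _ _ => rfl⟩
  | succ n ih =>
    intro A d w h0 hA hd
    push_cast at hA
    have t0 : 0 ≤ min A 1 := le_min h0 zero_le_one
    have t1 : A - min A 1 ≤ n := by
      rcases min_choice A 1 with h | h <;> rw [h]
      · simp
      · linarith
    have h1 := JeepStep.load (D := D) ⟨0, 0, d, w⟩ (min A 1) t0 ((min_le_left _ _).trans hd)
      (by simp)
    have h2 := JeepStep.returnAtBorder (D := D)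
      ⟨0, 0 + min A 1, Function.update d 0 (d 0 - min A 1), w⟩ (min A 1) ha rfl t0 (by simp)
    simp only [zero_add, sub_self] at h1 h2
    obtain ⟨d', h3, h4, h5⟩ := ih (Function.update d 0 (d 0 - min A 1)) (w - min A 1)
      (sub_nonneg.2 (min_le_left A 1)) t1 (by simpa using hd)
    rw [show w - min A 1 - (A - min A 1) = w - A by ring] at h3
    refine ⟨d', by simpa using ((Run.single h1).trans (Run.single h2)).trans h3, ?_, fun z hz => ?_⟩
    · rw [h4]
      simp
    · rw [h5 z hz]
      simp [hz]

/-- A plan on arrival at the border gives a trip that uses the border fuel of the convoy. -/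
theorem Plan.exists_run {c : Convoy} {F B : ℝ → ℕ} (h : Plan D c F B) (hc : c.Sound D)
    (h0 : c.pos = 0) : ∃ v e, Run D v (JeepState.start D) e F B ∧
      (v ∨ e.pos = D.oasis) ∧ e.pos = (if D.roundTrip then 0 else D.oasis) ∧
      (∀ x, 0 < x → e.depot x = D.demand x) ∧ e.used = c.borderFuel D := by
  have hs0 := D.supply_eq_zero (x := 0) (Or.inl le_rfl)
  have hd0 := D.demand_eq_zero (x := 0) (Or.inl le_rfl)
  have hA : 0 ≤ c.outward := by
    have := hc.fwdFuel_le
    have : (0 : ℝ) ≤ c.fwd := Nat.cast_nonneg _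
    simp only [Convoy.outward]
    linarith
  have hC : 0 ≤ c.homeward := sub_nonneg.2 hc.bwd_le_bwdFuel
  have hneed : c.need D = c.outward := by simp [Convoy.need, h0, hs0, (hc.border h0).2]
  have hleft : c.left D = c.homeward := by simp [Convoy.left, h0, hd0, (hc.border h0).1]
  obtain ⟨n, hn⟩ := exists_nat_ge c.outward
  obtain ⟨m, hm⟩ := exists_nat_ge c.homeward
  obtain ⟨d1, r1, a1, b1⟩ := exists_run_fill (D := D) n (fun x => (D.supply x : ℝ)) 0 hA hn
  rw [zero_add] at r1
  simp only [hs0, NNReal.coe_zero, zero_add] at a1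
  -- Without credit the homeward fuel just stays at the border, hence only an inequality at `0`.
  have credit : ∀ d : ℝ → ℝ, c.homeward ≤ d 0 →
      ∃ d', Run D False ⟨0, 0, d, c.outward⟩ ⟨0, 0, d', c.borderFuel D⟩ 0 0 ∧
        d 0 - c.homeward ≤ d' 0 ∧ ∀ z, z ≠ 0 → d' z = d z := by
    intro d hd
    cases ha : D.returnAllowed
    · refine ⟨d, ?_, by linarith, fun _ _ => rfl⟩
      have : c.borderFuel D = c.outward := by simp [Convoy.borderFuel, Convoy.outward, ha]
      rw [this]
      exact .refl _
    · obtain ⟨d', h1, h2, h3⟩ := exists_run_return ha m d c.outward hC hm hd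
      have : c.borderFuel D = c.outward - c.homeward := by
        simp [Convoy.borderFuel, Convoy.outward, Convoy.homeward, ha]
      rw [this]
      exact ⟨d', h1, h2.ge, h3⟩
  obtain ⟨-, h⟩ := h
  rw [h0, hneed, hleft] at h
  rcases h with ⟨hrt, hout⟩ | ⟨hrt, r, E, F₁, B₁, F₂, B₂, hr0, hout, hhome, rfl, rfl⟩
  · obtain ⟨d2, r2, a2, b2, -⟩ := hout d1 c.outward (fun z hz => b1 z hz.ne') a1.ge
    obtain ⟨d3, r3, -, b3⟩ := credit d2 (by rw [b2, a1]; linarith)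
    have := (r1.trans r2).trans r3
    simp only [zero_add, add_zero] at this
    exact ⟨_, _, this, Or.inl (by simp), by simp [hrt],
      fun x hx => (b3 x hx.ne').trans (a2 x hx), rfl⟩
  · obtain ⟨d2, r2, a2, b2, -⟩ := hout d1 c.outward (fun z hz => b1 z hz.ne') a1.ge
    -- Credit is taken between the `OutPlan` and the final ride; the reserve `r` remains for that
    -- ride.
    obtain ⟨d3, r3, a3, b3⟩ := credit d2 (by rw [b2, a1]; linarith)
    obtain ⟨d4, r4, a4, -⟩ := hhome d3 (c.borderFuel D)
      (fun z hz => by rw [b3 z hz.ne', a2 z hz]) (by rw [b2, a1] at a3; linarith)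
    have := ((r1.trans r2).trans r3).trans r4
    simp only [zero_add, add_zero] at this
    exact ⟨_, _, this, Or.inr rfl, by simp [hrt], a4, rfl⟩

theorem IsConvoyAlgorithm.exists_executes {T : List Convoy} {c : Convoy}
    (h : IsConvoyAlgorithm D T c) : ∃ S e, Executes D S e T c := by
  obtain ⟨h1, h2, h3, h4⟩ := h
  obtain ⟨T, rfl⟩ : ∃ T', T = Convoy.start D :: T' := by
    cases T with
    | nil => simp at h1
    | cons a T => exact ⟨T, by simpa using h1⟩
  obtain ⟨hc, F, B, hp, -, hpass⟩ :=
    Plan.exists_final T (plan_start D) (Convoy.sound_start D) h2 h3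
  obtain ⟨v, e, hrun, hv, hend, hdep, hfuel⟩ := hp.exists_run hc h4
  obtain ⟨S, s1, s2, s3, s4, s5⟩ := hrun.exists_list
  refine ⟨_ :: S, e, ⟨rfl, s1, s2, ?_, hend⟩, hdep, hfuel, fun p hp => ?_⟩
  · exact hv.elim s3 fun he => ⟨e, List.mem_of_getLast? s2, he⟩
  · convert Set.finite_empty using 1
    refine Set.eq_empty_of_forall_notMem fun x hx => hx.2.2 ?_
    rw [s4, s5]
    exact hpass p hp x hx.1 hx.2.1

end FineJeep

theorem mainTheorem1 (D : FineJeep.Desert) :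
    (∃ T c, FineJeep.IsConvoyAlgorithm D T c) ∧
    ∀ T c, FineJeep.IsConvoyAlgorithm D T c →
      (∀ S e, FineJeep.IsNormalAlgorithm D S e → (∀ x, (D.demand x : ℝ) ≤ e.depot x) →
        c.borderFuel D ≤ e.used) ∧
      (∃ S e, FineJeep.Executes D S e T c) :=
  ⟨FineJeep.exists_isConvoyAlgorithm D, fun _ _ h =>
    ⟨fun _ _ hS hd => h.borderFuel_le hS hd, h.exists_executes⟩⟩
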